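/- Let $M$ be a Riemann surface and let $X=f(z)\,\partial/\partial z$ be a singular complex analytic vector field on $M$. This means the following. Let $\mathcal Z,\mathcal P,E$ be the sets of isolated zeros, poles and isolated essential singularities of $X$, and let $\mathrm{Sing}(X)=\overline{\mathcal Z\cup\mathcal P\cup E}$; then $X$ is holomorphic and non-vanishing on $M^0=M\setminus \mathrm{Sing}(X)$. Let $M^*$ be the complement in $M$ of $\mathcal P\cup E$ and of the accumulation points of $\mathcal Z\cup\mathcal P\cup E$. Let $\omega_X=dz/f$ be the holomorphic $1$-form on $M^0$ with $\omega_X(X)\equiv1$. Fix $z_0\in M^0$. Let $\Psi_X(z)=\int_{z_0}^z\omega_X$ be the (in general multivalued) distinguished parameter, whose values at $z$ are the integrals of $\omega_X$ along all piecewise $C^1$ paths in $M^0$ from $z_0$ to $z$. Let $$\mathcal R_X=\mathcal R_{X,z_0}=\{(z,t)\in M\times\mathbb C_t : t \text{ is a value of } \Psi_X \text{ at } z\}$$ be its graph, with the topology generated by the graphs of the holomorphic primitives of $\omega_X$ on open subsets of $M^0$ (intersected with $\mathcal R_X$). Let $\pi_1:\mathcal R_X\to M$ and $\pi_2:\mathcal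 R_X\to\mathbb C_t$ be the projections. Then the following hold. 1. $\mathcal R_X$ carries a complex structure that makes it a (connected, Hausdorff) Riemann surface for which $\pi_1$ and $\pi_2$ are local biholomorphisms. The local flow $t\mapsto\varphi(z_0,t)$, i.e. the germ at $t=0$ of a holomorphic map into $M^*$ with $\partial_t\varphi=X(\varphi)$ and $\varphi(z_0,0)=z_0$, exists. Its maximal analytic continuation as a holomorphic map into $M^*$ is single-valued on $\mathcal R_X$: it is $\pi_1$ on the surface $\mathcal R_X$ spread over $\mathbb C_t$ by $\pi_2$, with base point $(z_0,0)$. That is, $(\mathcal R_X,\pi_2,\pi_1,(z_0,0))$ is an analytic continuation of the germ, and every analytic continuation of it on a Riemann surface spread over $\mathbb C_t$ factors through it by a unique holomorphic map that respects the projections to $\mathbb C_t$, the maps to $M^*$ and the base points. 2. $X+\partial/\partial t$ is a holomorphic vector field on the open set $M^*\times\mathbb C_t$, and the Riemann surface $\mathcal R_X$, with its inclusion in $M\times\mathbb C_t$, is a leaf (a maximal connected injectively immersed integral manifold) of the foliation $\mathcal F$ that it defines on $M^*\times\mathbb C_t$. A change of the initial condition translates $\mathcal R_X$ in $t$: for every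 $z_1$ in the connected component of $M^0$ that contains $z_0$, the function $\Psi_X$ has at least one value at $z_1$, and for every value $c$ of $\Psi_X$ at $z_1$, $$\mathcal R_{X,z_0}=\{(z,t+c) : (z,t)\in\mathcal R_{X,z_1}\}.$$ If $\mathrm{Sing}(X)$ is countable, this component contains every point of $M^0$ that lies in the same connected component of $M$ as $z_0$; so if moreover $M$ is connected, it is all of $M^0$. -/

import Mathlib

open scoped Manifold ContDiff Topology

universe u v

noncomputable section

namespace ComplexFlow

/-- A connected Hausdorff one-dimensional complex manifold. -/
structure IsRiemannSurface (Y : Type v) [TopologicalSpace Y] [ChartedSpace ℂ Y] : Prop where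
  isManifold : IsManifold 𝓘(ℂ, ℂ) ω Y
  t2 : T2Space Y
  connected : ConnectedSpace Y

section VectorField

variable {M : Type u} [TopologicalSpace M] [ChartedSpace ℂ M]

/-- The coefficient `f` of the vector field `X = f ∂/∂z` in the preferred chart at `p`, as a
function of the coordinate `w`. -/
def coeff (X : ∀ z : M, TangentSpace 𝓘(ℂ, ℂ) z) (p : M) (w : ℂ) : ℂ :=
  mfderiv 𝓘(ℂ, ℂ) 𝓘(ℂ, ℂ) (chartAt ℂ p) ((chartAt ℂ p).symm w) (X ((chartAt ℂ p).symm w))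

/-- Isolated zeros of `X`. -/
def zeroSet (X : ∀ z : M, TangentSpace 𝓘(ℂ, ℂ) z) : Set M :=
  {p | AnalyticAt ℂ (coeff X p) (chartAt ℂ p p) ∧ coeff X p (chartAt ℂ p p) = 0 ∧
    ∀ᶠ w in 𝓝[≠] (chartAt ℂ p p), coeff X p w ≠ 0}

/-- Poles of `X`. The value of `X` at a pole is irrelevant. -/
def poleSet (X : ∀ z : M, TangentSpace 𝓘(ℂ, ℂ) z) : Set M :=
  {p | MeromorphicAt (coeff X p) (chartAt ℂ p p) ∧
    meromorphicOrderAt (coeff X p) (chartAt ℂ p p) < 0}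

/-- Isolated essential singularities of `X`. The value of `X` there is irrelevant. -/
def essentialSet (X : ∀ z : M, TangentSpace 𝓘(ℂ, ℂ) z) : Set M :=
  {p | (∀ᶠ w in 𝓝[≠] (chartAt ℂ p p), AnalyticAt ℂ (coeff X p) w) ∧
    ¬ MeromorphicAt (coeff X p) (chartAt ℂ p p)}

/-- The singular set: the zeros, poles and isolated essential singularities of `X` together with
their accumulation points. -/
def singSet (X : ∀ z : M, TangentSpace 𝓘(ℂ, ℂ) z) : Set M :=
  closure (zeroSet X ∪ poleSet X ∪ essentialSet X)

/-- `X` is a singular complex analytic vector field: it is holomorphic and non-vanishing off its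
singular set. On the poles, the essential singularities and the accumulation points, where the
vector field is not defined, the function `X` takes arbitrary values. -/
def IsSingularAnalytic (X : ∀ z : M, TangentSpace 𝓘(ℂ, ℂ) z) : Prop :=
  ∀ p ∉ singSet X, AnalyticAt ℂ (coeff X p) (chartAt ℂ p p) ∧ X p ≠ 0

/-- `M*`: the complement of the poles, the essential singularities, and the accumulation points
of zeros, poles and essential singularities. -/
def starSet (X : ∀ z : M, TangentSpace 𝓘(ℂ, ℂ) z) : Set M :=
  (poleSet X ∪ essentialSet X ∪ derivedSet (zeroSet X ∪ poleSet X ∪ essentialSet X))ᶜ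

/-- The dual form `ω_X = dz / f`, i.e. the form with `ω_X(X) = 1` wherever `X ≠ 0`. The tangent
space at `z` is a copy of `ℂ`, by the coordinate of the preferred chart at `z`. -/
def dualForm (X : ∀ z : M, TangentSpace 𝓘(ℂ, ℂ) z) (z : M) : TangentSpace 𝓘(ℂ, ℂ) z →L[ℂ] ℂ :=
  (show ℂ from X z)⁻¹ • ContinuousLinearMap.id ℂ ℂ

/-- The integral of `ω_X` along the arc `γ : [0,1] → M`. -/
def arcIntegral (X : ∀ z : M, TangentSpace 𝓘(ℂ, ℂ) z) (γ : ℝ → M) : ℂ :=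
  ∫ s in (0 : ℝ)..1, dualForm X (γ s)
    (mfderivWithin 𝓘(ℝ, ℝ) 𝓘(ℝ, ℂ) γ (Set.Icc 0 1) s (1 : ℝ))

/-- `IsPsiValue X z₀ z t`: the number `t` is a value at `z` of the (multivalued) distinguished
parameter `Ψ_X(z) = ∫_{z₀}^z ω_X`, i.e. the integral of `ω_X` along some piecewise `C¹` path from
`z₀` to `z` in the complement of the singular set. The path is given as a finite succession of
`C¹` arcs. -/
inductive IsPsiValue (X : ∀ z : M, TangentSpace 𝓘(ℂ, ℂ) z) (z₀ : M) : M → ℂ → Prop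
  | base (h : z₀ ∉ singSet X) : IsPsiValue X z₀ z₀ 0
  | arc {t : ℂ} (γ : ℝ → M) (h : IsPsiValue X z₀ (γ 0) t)
      (hγ : ContMDiffOn 𝓘(ℝ, ℝ) 𝓘(ℝ, ℂ) 1 γ (Set.Icc 0 1))
      (hs : ∀ s ∈ Set.Icc (0 : ℝ) 1, γ s ∉ singSet X) :
      IsPsiValue X z₀ (γ 1) (t + arcIntegral X γ)

/-- The graph of the multivalued function `Ψ_X`, as a subset of `M × ℂ`. -/
def psiGraph (X : ∀ z : M, TangentSpace 𝓘(ℂ, ℂ) z) (z₀ : M) : Set (M × ℂ) :=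
  {q | IsPsiValue X z₀ q.1 q.2}

/-- The Riemann surface `R_X` of `Ψ_X`: its points are those of the graph of `Ψ_X`, its topology
(below) is in general finer than the one induced from `M × ℂ`. -/
def RSurface (X : ∀ z : M, TangentSpace 𝓘(ℂ, ℂ) z) (z₀ : M) : Type u :=
  {q : M × ℂ // q ∈ psiGraph X z₀}

namespace RSurface

variable {X : ∀ z : M, TangentSpace 𝓘(ℂ, ℂ) z} {z₀ : M}

/-- The inclusion into `M × ℂ`. -/
def incl (r : RSurface X z₀) : M × ℂ := r.1

/-- The projection to `M`. -/
def fst (r : RSurface X z₀) : M := r.incl.1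

/-- The projection to `ℂ_t`. -/
def snd (r : RSurface X z₀) : ℂ := r.incl.2

/-- The base point `(z₀, 0)`. -/
def basePoint (X : ∀ z : M, TangentSpace 𝓘(ℂ, ℂ) z) (z₀ : M) (h : z₀ ∉ singSet X) :
    RSurface X z₀ :=
  ⟨(z₀, 0), IsPsiValue.base h⟩

/-- The topology of the graph of a multivalued function: the open sets are generated by the graphs
`{(z, ψ z) | z ∈ V}` of the single-valued branches, where `ψ` is a primitive of `ω_X` on an open
set `V` of regular points. -/
instance : TopologicalSpace (RSurface X z₀) :=
  TopologicalSpace.generateFrom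
    {S | ∃ (V : Set M) (ψ : M → ℂ), IsOpen V ∧ V ⊆ (singSet X)ᶜ ∧
      (∀ z ∈ V, HasMFDerivAt 𝓘(ℂ, ℂ) 𝓘(ℂ, ℂ) ψ z (dualForm X z)) ∧
      S = {r | r.fst ∈ V ∧ r.snd = ψ r.fst}}

end RSurface

/-- `φ` (near `0`) is the local flow `t ↦ φ(z₀, t)` of `X` in complex time: the holomorphic
solution of `dφ/dt = X(φ)`, `φ(0) = z₀`, with values in `M*`. -/
def IsLocalFlow (X : ∀ z : M, TangentSpace 𝓘(ℂ, ℂ) z) (z₀ : M) (φ : ℂ → M) : Prop :=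
  φ 0 = z₀ ∧ ∀ᶠ t in 𝓝 (0 : ℂ), φ t ∈ starSet X ∧
    HasMFDerivAt 𝓘(ℂ, ℂ) 𝓘(ℂ, ℂ) φ t
      (ContinuousLinearMap.toSpanSingleton ℂ (X (φ t)))

end VectorField

section Continuation

variable {M : Type u} [TopologicalSpace M] [ChartedSpace ℂ M]

/-- `(Y, p, F, b)` is an analytic continuation of the germ at `t₀` of the holomorphic map `φ` with
values in `U ⊆ M`: `Y` is a Riemann surface spread over `ℂ` by the local biholomorphism `p`, and
`F : Y → U` is a holomorphic map which near `b`, a point over `t₀`, is `φ` read through `p`. -/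
structure IsAnalyticContinuation (U : Set M) (φ : ℂ → M) (t₀ : ℂ)
    {Y : Type v} [TopologicalSpace Y] [ChartedSpace ℂ Y]
    (p : Y → ℂ) (F : Y → M) (b : Y) : Prop where
  isRiemannSurface : IsRiemannSurface Y
  isLocalDiffeomorph : IsLocalDiffeomorph 𝓘(ℂ, ℂ) 𝓘(ℂ, ℂ) ω p
  holomorphic : ContMDiff 𝓘(ℂ, ℂ) 𝓘(ℂ, ℂ) ω F
  mem : ∀ y, F y ∈ U
  map_base : p b = t₀
  germ : ∀ᶠ y in 𝓝 b, F y = φ (p y)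

/-- `(Y, p, F, b)` is the maximal analytic continuation: every other analytic continuation of the
germ factors, in a unique way, holomorphically through it. -/
def IsMaximalAnalyticContinuation (U : Set M) (φ : ℂ → M) (t₀ : ℂ)
    {Y : Type u} [TopologicalSpace Y] [ChartedSpace ℂ Y]
    (p : Y → ℂ) (F : Y → M) (b : Y) : Prop :=
  IsAnalyticContinuation U φ t₀ p F b ∧
  ∀ (Z : Type v) [TopologicalSpace Z] [ChartedSpace ℂ Z] (q : Z → ℂ) (G : Z → M) (c : Z),
    IsAnalyticContinuation U φ t₀ q G c →
    ∃! h : Z → Y, ContMDiff 𝓘(ℂ, ℂ) 𝓘(ℂ, ℂ) ω h ∧ p ∘ h = q ∧ F ∘ h = G ∧ h c = b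

end Continuation

section Foliation

variable {M : Type u} [TopologicalSpace M] [ChartedSpace ℂ M]

/-- The vector field `X + ∂/∂t` on `M × ℂ_t`. -/
def suspension (X : ∀ z : M, TangentSpace 𝓘(ℂ, ℂ) z) (q : M × ℂ) :
    TangentSpace (𝓘(ℂ, ℂ).prod 𝓘(ℂ, ℂ)) q :=
  ((X q.1 : ℂ), (1 : ℂ))

/-- `i : L → M × ℂ` is a connected (injectively immersed) integral manifold, inside `U`, of the
foliation tangent to the vector field `Y`. -/
structure IsIntegralManifold
    (Y : ∀ q : M × ℂ, TangentSpace (𝓘(ℂ, ℂ).prod 𝓘(ℂ, ℂ)) q) (U : Set (M × ℂ))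
    {L : Type v} [TopologicalSpace L] [ChartedSpace ℂ L] (i : L → M × ℂ) : Prop where
  isRiemannSurface : IsRiemannSurface L
  holomorphic : ContMDiff 𝓘(ℂ, ℂ) (𝓘(ℂ, ℂ).prod 𝓘(ℂ, ℂ)) ω i
  injective : Function.Injective i
  mem : ∀ l, i l ∈ U
  immersion : ∀ l, Function.Injective (mfderiv 𝓘(ℂ, ℂ) (𝓘(ℂ, ℂ).prod 𝓘(ℂ, ℂ)) i l)
  tangent : ∀ l, LinearMap.range
      (mfderiv 𝓘(ℂ, ℂ) (𝓘(ℂ, ℂ).prod 𝓘(ℂ, ℂ)) i l).toLinearMap = Submodule.span ℂ {Y (i l)}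

/-- `i : L → M × ℂ` is a leaf of the foliation of `U` tangent to `Y`: a maximal connected integral
manifold, that is, one through which every connected integral manifold meeting it factors. -/
def IsLeaf (Y : ∀ q : M × ℂ, TangentSpace (𝓘(ℂ, ℂ).prod 𝓘(ℂ, ℂ)) q) (U : Set (M × ℂ))
    {L : Type u} [TopologicalSpace L] [ChartedSpace ℂ L] (i : L → M × ℂ) : Prop :=
  IsIntegralManifold Y U i ∧
  ∀ (L' : Type v) [TopologicalSpace L'] [ChartedSpace ℂ L'] (j : L' → M × ℂ),
    IsIntegralManifold Y U j → (Set.range i ∩ Set.range j).Nonempty →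
    ∃ h : L' → L, ContMDiff 𝓘(ℂ, ℂ) 𝓘(ℂ, ℂ) ω h ∧ i ∘ h = j

end Foliation

end ComplexFlow

end

/-!
Off the singular set the vector field `X` can be rectified: in a chart with coefficient `f`, a
primitive of `1 / f` is a coordinate in which `X` is `∂/∂t`. Such a *flow box* `e`
(`exists_isFlowBox`) is at the same time a local branch of `Ψ_X`, and its inverse is a local
solution of `dφ/dt = X(φ)`. Its graph, translated in `t`, is a *plaque*
`{(z, e z + a) | z ∈ e.source}`, and everything follows from the way in which sets of points of
`M × ℂ` meet plaques.

A set which contains every plaque that it meets is stable under `(γ 0, t) ↦ (γ 1, t + ∫_γ ω_X)` for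
each `C¹` arc `γ` of regular points, because `∫ ω_X - e ∘ γ` is locally constant along the arc
(`IsSaturated.arc_mem`). The graph of `Ψ_X` is the smallest such set through `(z₀, 0)`
(`isSaturated_psiGraph`, `IsPsiValue.mem_of_isSaturated`). Applied to suitable sets, this shows that
the values of `Ψ_X` can be inverted and composed (`IsPsiValue.symm`, `IsPsiValue.trans`), which is
the statement on the change of the initial condition, and that `R_X` is connected
(`RSurface.connectedSpace`). The plaques are open in `R_X`, and `π₂` maps each of them
homeomorphically onto an open set of `ℂ` (`RSurface.exists_plaque`). So `π₂` is a local
homeomorphism and its local inverses form an atlas, for which the changes of coordinates are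
restrictions of the identity.

Both the maximality of the continuation and that of the leaf concern a pair of maps `G : Z → M*`,
`q : Z → ℂ` on a connected Riemann surface with `dG = X(G) dq` (`IsFlowMapAt`). For an integral
manifold of `X + ∂/∂t` this relation is the tangency condition; for an analytic continuation of the
flow it holds near the base point, hence everywhere by the identity theorem
(`isFlowMapAt_of_eventually`). If `(G, q)` meets `R_X` then it stays in `R_X`
(`mem_psiGraph_of_isFlowMapAt`): near a regular value of `G` it stays in a plaque since
`d(e ∘ G - q) = 0`, and where `G` takes a zero of `X` as a value it is locally constant by
uniqueness of solutions (`eventually_eq_of_mem_zeroSet`), so that the set of these points is open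
and closed and does not contain the base point. The resulting map `Z → R_X` is the factorization
(`RSurface.exists_lift`).
-/

noncomputable section

namespace ComplexFlow

variable {M : Type u} [TopologicalSpace M] [ChartedSpace ℂ M]

/-! ### Flow boxes -/

section FlowBoxes

variable {X : ∀ z : M, TangentSpace 𝓘(ℂ, ℂ) z}

theorem coeff_chartAt {p z : M} (hz : z ∈ (chartAt ℂ p).source) :
    coeff X p (chartAt ℂ p z) = mfderiv 𝓘(ℂ, ℂ) 𝓘(ℂ, ℂ) (chartAt ℂ p) z (X z) := by
  unfold coeff
  rw [(chartAt ℂ p).left_inv hz]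

theorem isOpen_compl_singSet : IsOpen (singSet X)ᶜ := isClosed_closure.isOpen_compl

/-- `e` is a flow box of `X`: a holomorphic coordinate on an open set of regular points which is a
primitive of `ω_X`, so that `X` becomes `∂/∂t` and the inverse of `e` solves `dφ/dt = X(φ)`. The
target is convex, so that any two points of the source are joined by an arc which `e` maps to a
segment. -/
structure IsFlowBox (X : ∀ z : M, TangentSpace 𝓘(ℂ, ℂ) z) (e : OpenPartialHomeomorph M ℂ) :
    Prop where
  source_subset : e.source ⊆ (singSet X)ᶜ
  convex_target : Convex ℝ e.target
  contMDiffOn : ContMDiffOn 𝓘(ℂ, ℂ) 𝓘(ℂ, ℂ) ω e e.source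
  contMDiffOn_symm : ContMDiffOn 𝓘(ℂ, ℂ) 𝓘(ℂ, ℂ) ω e.symm e.target
  hasMFDerivAt : ∀ z ∈ e.source, HasMFDerivAt 𝓘(ℂ, ℂ) 𝓘(ℂ, ℂ) e z (dualForm X z)
  hasMFDerivAt_symm : ∀ t ∈ e.target, HasMFDerivAt 𝓘(ℂ, ℂ) 𝓘(ℂ, ℂ) e.symm t
    (ContinuousLinearMap.toSpanSingleton ℂ (X (e.symm t)))

theorem isManifold_one [IsManifold 𝓘(ℂ, ℂ) ω M] : IsManifold 𝓘(ℂ, ℂ) 1 M :=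
  IsManifold.of_le (n := ω) le_top

/-- The inverse of a primitive of `ω_X` is a solution of `dφ/dt = X(φ)`. -/
theorem hasMFDerivAt_symm_of_primitive (e : OpenPartialHomeomorph M ℂ) {t : ℂ}
    (ht : t ∈ e.target)
    (he : HasMFDerivAt 𝓘(ℂ, ℂ) 𝓘(ℂ, ℂ) e (e.symm t) (dualForm X (e.symm t)))
    (hX : X (e.symm t) ≠ 0)
    (hs : MDifferentiableAt 𝓘(ℂ, ℂ) 𝓘(ℂ, ℂ) e.symm t) :
    HasMFDerivAt 𝓘(ℂ, ℂ) 𝓘(ℂ, ℂ) e.symm t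
      (ContinuousLinearMap.toSpanSingleton ℂ (X (e.symm t))) := by
  have h1 := HasMFDerivAt.comp t he hs.hasMFDerivAt
  have h2 : HasMFDerivAt 𝓘(ℂ, ℂ) 𝓘(ℂ, ℂ) (e ∘ e.symm) t (ContinuousLinearMap.id ℂ ℂ) := by
    refine (hasMFDerivAt_id t).congr_of_eventuallyEq ?_
    filter_upwards [e.open_target.mem_nhds ht] with s hs using e.right_inv hs
  have h3 := hasMFDerivAt_unique h1 h2
  refine hs.hasMFDerivAt.congr_mfderiv (ContinuousLinearMap.ext fun v => ?_)
  have key (L : ℂ →L[ℂ] ℂ) (x v : ℂ) (hx : x ≠ 0) (h : x⁻¹ * L v = v) : v * x = L v := by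
    rw [inv_mul_eq_iff_eq_mul₀ hx] at h
    rw [h, mul_comm]
  exact (key (mfderiv 𝓘(ℂ, ℂ) 𝓘(ℂ, ℂ) e.symm t) (X (e.symm t)) v hX
    (congrArg (fun T : ℂ →L[ℂ] ℂ => T v) h3)).symm

variable [IsManifold 𝓘(ℂ, ℂ) ω M]

theorem hasMFDerivAt_chartAt {p z : M} (hz : z ∈ (chartAt ℂ p).source) :
    HasMFDerivAt 𝓘(ℂ, ℂ) 𝓘(ℂ, ℂ) (chartAt ℂ p) z
      (mfderiv 𝓘(ℂ, ℂ) 𝓘(ℂ, ℂ) (chartAt ℂ p) z) :=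
  have := isManifold_one (M := M)
  (mdifferentiableAt_atlas (chart_mem_atlas ℂ p) hz).hasMFDerivAt

theorem coeff_ne_zero {p z : M} (hz : z ∈ (chartAt ℂ p).source) (h : X z ≠ 0) :
    coeff X p (chartAt ℂ p z) ≠ 0 := by
  have := isManifold_one (M := M)
  rw [coeff_chartAt hz]
  intro h0
  apply h
  exact (mdifferentiable_chart p).mfderiv_injective hz (h0.trans (map_zero _).symm)

/-- A primitive of `1 / f` in the coordinate of the chart is a primitive of `ω_X` on `M`. -/
theorem hasMFDerivAt_primitive_comp_chartAt {p z : M} (hz : z ∈ (chartAt ℂ p).source)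
    (h : coeff X p (chartAt ℂ p z) ≠ 0) {g : ℂ → ℂ}
    (hg : HasDerivAt g (coeff X p (chartAt ℂ p z))⁻¹ (chartAt ℂ p z)) :
    HasMFDerivAt 𝓘(ℂ, ℂ) 𝓘(ℂ, ℂ) (g ∘ chartAt ℂ p) z (dualForm X z) := by
  refine (HasMFDerivAt.comp z hg.hasFDerivAt.hasMFDerivAt (hasMFDerivAt_chartAt hz)).congr_mfderiv
    (ContinuousLinearMap.ext fun v => ?_)
  rw [coeff_chartAt hz] at h
  have key (L : ℂ →L[ℂ] ℂ) (x v : ℂ) (h : L x ≠ 0) : x⁻¹ * v = L v * (L x)⁻¹ := by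
    have hL (y : ℂ) : L y = y * L 1 := by rw [← smul_eq_mul, ← map_smul, smul_eq_mul, mul_one]
    rw [hL x] at h ⊢
    rw [hL v]
    have h1 := left_ne_zero_of_mul h
    have h2 := right_ne_zero_of_mul h
    field_simp
  have := key (mfderiv 𝓘(ℂ, ℂ) 𝓘(ℂ, ℂ) (chartAt ℂ p) z) (X z) v h
  rw [coeff_chartAt hz]
  exact this.symm

/-- Rectification: every regular point has a flow box, with any prescribed value at the point. The
coordinate is a primitive of `1 / f` near the point, inverted by the inverse function theorem. -/
theorem exists_isFlowBox (hX : IsSingularAnalytic X) {p : M} (hp : p ∉ singSet X) (c : ℂ) :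
    ∃ e : OpenPartialHomeomorph M ℂ, IsFlowBox X e ∧ p ∈ e.source ∧ e p = c := by
  set κ := chartAt ℂ p with hκ
  have hpκ : p ∈ κ.source := mem_chart_source ℂ p
  have hf0 : coeff X p (κ p) ≠ 0 := coeff_ne_zero hpκ (hX p hp).2
  obtain ⟨r, hr, hball⟩ : ∃ r > 0, Metric.ball (κ p) r ⊆
      {w | AnalyticAt ℂ (coeff X p) w ∧ coeff X p w ≠ 0 ∧ κ.symm w ∈ (singSet X)ᶜ} := by
    refine Metric.mem_nhds_iff.1 ?_
    filter_upwards [(hX p hp).1.eventually_analyticAt, (hX p hp).1.continuousAt.eventually_ne hf0,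
      (κ.continuousAt_symm (κ.map_source hpκ)).preimage_mem_nhds
        (isOpen_compl_singSet.mem_nhds (by rwa [κ.left_inv hpκ]))] with w h1 h2 h3
    exact ⟨h1, h2, h3⟩
  have hdiff : DifferentiableOn ℂ (fun w => (coeff X p w)⁻¹) (Metric.ball (κ p) r) := fun w hw =>
    ((hball hw).1.differentiableAt.inv (hball hw).2.1).differentiableWithinAt
  obtain ⟨g, hgc, hg⟩ := hdiff.isExactOn_ball.with_val_at (κ p) c
  have hgcd : ∀ w ∈ Metric.ball (κ p) r, ContDiffAt ℂ ω g w := fun w hw =>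
    (DifferentiableOn.analyticOnNhd (fun v hv => (hg v hv).differentiableAt.differentiableWithinAt)
      Metric.isOpen_ball w hw).contDiffAt
  have hmem : κ p ∈ Metric.ball (κ p) r := Metric.mem_ball_self hr
  have hder : HasFDerivAt g ((ContinuousLinearEquiv.unitsEquivAut ℂ
      (Units.mk0 _ (inv_ne_zero hf0)) : ℂ ≃L[ℂ] ℂ) : ℂ →L[ℂ] ℂ) (κ p) := by
    convert! (hg _ hmem).hasFDerivAt using 1
  set e₁ := (hgcd _ hmem).toOpenPartialHomeomorph g hder (by simp) with he₁
  have he₁g : (e₁ : ℂ → ℂ) = g := (hgcd _ hmem).toOpenPartialHomeomorph_coe hder (by simp)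
  have he₁p : κ p ∈ e₁.source := (hgcd _ hmem).mem_toOpenPartialHomeomorph_source hder (by simp)
  set e₂ := κ.trans (e₁.restrOpen _ Metric.isOpen_ball : OpenPartialHomeomorph ℂ ℂ) with he₂
  have hp₂ : p ∈ e₂.source := ⟨hpκ, he₁p, hmem⟩
  have hp₂c : e₂ p = c := by
    change e₁ (κ p) = c
    rw [he₁g, hgc]
  obtain ⟨ε, hε, hεt⟩ := Metric.mem_nhds_iff.1
    (e₂.open_target.mem_nhds (hp₂c ▸ e₂.map_source hp₂))
  set e := (e₂.symm.restrOpen _ (Metric.isOpen_ball (x := c) (ε := ε))).symm with he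
  have hsource : e.source ⊆ e₂.source := fun z hz => (e.map_source hz).1 |> fun h => by
    have := e₂.map_target h
    rwa [show e₂.symm (e z) = z from e.left_inv hz] at this
  have htarget : e.target = Metric.ball c ε := by
    change e₂.target ∩ Metric.ball c ε = _
    exact Set.inter_eq_right.2 hεt
  have hcoe : (e : M → ℂ) = g ∘ κ := by
    change (e₁ : ℂ → ℂ) ∘ κ = _
    rw [he₁g]
  have hκs : ∀ z ∈ e.source, z ∈ κ.source := fun z hz => (hsource hz).1
  have hκb : ∀ z ∈ e.source, κ z ∈ Metric.ball (κ p) r := fun z hz => (hsource hz).2.2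
  have hsing : e.source ⊆ (singSet X)ᶜ := fun z hz => by
    have := (hball (hκb z hz)).2.2
    rwa [κ.left_inv (hκs z hz)] at this
  have hder' : ∀ z ∈ e.source, HasMFDerivAt 𝓘(ℂ, ℂ) 𝓘(ℂ, ℂ) e z (dualForm X z) := fun z hz => by
    rw [hcoe]
    exact hasMFDerivAt_primitive_comp_chartAt (hκs z hz) (hball (hκb z hz)).2.1 (hg _ (hκb z hz))
  have htmem : ∀ t ∈ e.target, t ∈ e₁.target ∧ e₁.symm t ∈ Metric.ball (κ p) r ∧
      e₁.symm t ∈ κ.target := fun t ht => by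
    obtain ⟨⟨h1, h2⟩, h3⟩ := ht.1
    exact ⟨h1, h2, h3⟩
  have hsymm : ContMDiffOn 𝓘(ℂ, ℂ) 𝓘(ℂ, ℂ) ω e.symm e.target := by
    have h1 : ContMDiffOn 𝓘(ℂ, ℂ) 𝓘(ℂ, ℂ) ω e₁.symm e.target := by
      intro t ht
      obtain ⟨ht1, htb, -⟩ := htmem t ht
      refine (ContDiffAt.contMDiffAt ?_).contMDiffWithinAt
      refine e₁.contDiffAt_symm_deriv (inv_ne_zero (hball htb).2.1) ht1 ?_ ?_
      · rw [he₁g]; exact hg _ htb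
      · rw [he₁g]; exact hgcd _ htb
    exact (contMDiffOn_chart_symm (x := p)).comp h1 fun t ht => (htmem t ht).2.2
  refine ⟨e, ⟨hsing, htarget ▸ convex_ball c ε, ?_, hsymm, hder', fun t ht => ?_⟩, ?_, ?_⟩
  · rw [hcoe]
    have h1 : ContMDiffOn 𝓘(ℂ, ℂ) 𝓘(ℂ, ℂ) ω g (Metric.ball (κ p) r) := fun w hw =>
      (hgcd w hw).contMDiffAt.contMDiffWithinAt
    exact h1.comp ((contMDiffOn_chart (x := p)).mono hκs) hκb
  · have h1 := e.map_target ht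
    exact hasMFDerivAt_symm_of_primitive e ht (hder' _ h1) (hX _ (hsing h1)).2
      ((hsymm.contMDiffAt (e.open_target.mem_nhds ht)).mdifferentiableAt (by simp))
  · have : e.symm c ∈ e.source := e.map_target (by rw [htarget]; exact Metric.mem_ball_self hε)
    rwa [show e.symm c = p by rw [← hp₂c]; exact e₂.left_inv hp₂] at this
  · rw [hcoe, Function.comp_apply, hgc]

end FlowBoxes

/-! ### Integration of the dual form along arcs -/

section Arcs

variable {X : ∀ z : M, TangentSpace 𝓘(ℂ, ℂ) z}

theorem hasMFDerivAt_restrictScalars {N : Type*} [TopologicalSpace N] [ChartedSpace ℂ N]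
    {g : M → N} {z : M} {g' : ℂ →L[ℂ] ℂ} (h : HasMFDerivAt 𝓘(ℂ, ℂ) 𝓘(ℂ, ℂ) g z g') :
    HasMFDerivAt 𝓘(ℝ, ℂ) 𝓘(ℝ, ℂ) g z (g'.restrictScalars ℝ) := by
  refine ⟨h.1, ?_⟩
  have h2 : HasFDerivWithinAt (writtenInExtChartAt 𝓘(ℂ, ℂ) 𝓘(ℂ, ℂ) z g) g' _ _ := h.2
  exact h2.restrictScalars ℝ

theorem contMDiffAt_restrictScalars {N : Type*} [TopologicalSpace N] [ChartedSpace ℂ N]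
    {n : WithTop ℕ∞} {g : M → N} {z : M} (h : ContMDiffAt 𝓘(ℂ, ℂ) 𝓘(ℂ, ℂ) n g z) :
    ContMDiffAt 𝓘(ℝ, ℂ) 𝓘(ℝ, ℂ) n g z := by
  rw [contMDiffAt_iff] at h ⊢
  exact ⟨h.1, h.2.restrict_scalars ℝ⟩

/-- The function that `arcIntegral` integrates: the value of `ω_X` on the velocity of `γ`. -/
def arcIntegrand (X : ∀ z : M, TangentSpace 𝓘(ℂ, ℂ) z) (γ : ℝ → M) (s : ℝ) : ℂ :=
  dualForm X (γ s) (mfderivWithin 𝓘(ℝ, ℝ) 𝓘(ℝ, ℂ) γ (Set.Icc 0 1) s (1 : ℝ))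

theorem IsFlowBox.hasDerivWithinAt_comp {e : OpenPartialHomeomorph M ℂ} (he : IsFlowBox X e)
    {γ : ℝ → M} {s : ℝ} (hγ : ContMDiffWithinAt 𝓘(ℝ, ℝ) 𝓘(ℝ, ℂ) 1 γ (Set.Icc 0 1) s)
    (hs : γ s ∈ e.source) :
    HasDerivWithinAt (e ∘ γ) (arcIntegrand X γ s) (Set.Icc 0 1) s := by
  have h1 := (hγ.mdifferentiableWithinAt one_ne_zero).hasMFDerivWithinAt
  have h2 := (hasMFDerivAt_restrictScalars (he.hasMFDerivAt _ hs)).comp_hasMFDerivWithinAt s h1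
  have h3 : HasFDerivWithinAt (e ∘ γ) (_ : ℝ →L[ℝ] ℂ) (Set.Icc 0 1) s :=
    hasMFDerivWithinAt_iff_hasFDerivWithinAt.1 h2
  exact h3.hasDerivWithinAt

theorem IsFlowBox.continuousWithinAt_arcIntegrand {e : OpenPartialHomeomorph M ℂ}
    (he : IsFlowBox X e) {γ : ℝ → M} (hγ : ContMDiffOn 𝓘(ℝ, ℝ) 𝓘(ℝ, ℂ) 1 γ (Set.Icc 0 1))
    {s : ℝ} (hs : s ∈ Set.Icc (0 : ℝ) 1) (hse : γ s ∈ e.source) :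
    ContinuousWithinAt (arcIntegrand X γ) (Set.Icc 0 1) s := by
  have h1 : ContMDiffWithinAt 𝓘(ℝ, ℝ) 𝓘(ℝ, ℂ) 1 (e ∘ γ) (Set.Icc 0 1) s :=
    ((contMDiffAt_restrictScalars ((he.contMDiffOn.contMDiffAt
      (e.open_source.mem_nhds hse)))).of_le le_top).comp_contMDiffWithinAt s (hγ s hs)
  have h2 := (h1.contDiffWithinAt.fderivWithin_right (m := 0) (uniqueDiffOn_Icc zero_lt_one)
    (by simp) hs).continuousWithinAt
  have h3 : ContinuousWithinAt (derivWithin (e ∘ γ) (Set.Icc 0 1)) (Set.Icc 0 1) s :=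
    h2.clm_apply continuousWithinAt_const
  have h4 : ∀ᶠ s' in 𝓝[Set.Icc 0 1] s, γ s' ∈ e.source :=
    (hγ s hs).continuousWithinAt (e.open_source.mem_nhds hse)
  refine h3.congr_of_eventuallyEq_of_mem ?_ hs
  filter_upwards [h4, self_mem_nhdsWithin] with s' h5 h6
  exact ((he.hasDerivWithinAt_comp (hγ s' h6) h5).derivWithin
    (uniqueDiffOn_Icc zero_lt_one s' h6)).symm

/-- `S ⊆ M × ℂ` is saturated: it contains every plaque `{(z, e z + a) | z ∈ e.source}`, for `e` a
flow box and `a` a constant, that it meets. -/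
def IsSaturated (X : ∀ z : M, TangentSpace 𝓘(ℂ, ℂ) z) (S : Set (M × ℂ)) : Prop :=
  ∀ e : OpenPartialHomeomorph M ℂ, IsFlowBox X e → ∀ (a : ℂ), ∀ z ∈ e.source, ∀ z' ∈ e.source,
    (z, e z + a) ∈ S → (z', e z' + a) ∈ S

variable [IsManifold 𝓘(ℂ, ℂ) ω M]

/-- The integrand of `∫_γ ω_X` is continuous, since in a flow box `e` it is the derivative of
`e ∘ γ`; so the indefinite integral is a primitive. -/
theorem exists_primitive_arcIntegrand (hX : IsSingularAnalytic X) {γ : ℝ → M}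
    (hγ : ContMDiffOn 𝓘(ℝ, ℝ) 𝓘(ℝ, ℂ) 1 γ (Set.Icc 0 1))
    (hs : ∀ s ∈ Set.Icc (0 : ℝ) 1, γ s ∉ singSet X) :
    ∃ F : ℝ → ℂ, F 0 = 0 ∧ F 1 = arcIntegral X γ ∧
      ∀ s ∈ Set.Icc (0 : ℝ) 1, HasDerivWithinAt F (arcIntegrand X γ s) (Set.Icc 0 1) s := by
  have hc : ContinuousOn (arcIntegrand X γ) (Set.Icc 0 1) := fun s hs' => by
    obtain ⟨e, he, hp, -⟩ := exists_isFlowBox hX (hs s hs') 0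
    exact he.continuousWithinAt_arcIntegrand hγ hs' hp
  have hG : Continuous (Set.IccExtend zero_le_one
      ((Set.Icc (0 : ℝ) 1).domRestrict (arcIntegrand X γ))) :=
    hc.domRestrict.Icc_extend'
  -- The integrand is junk outside of `[0, 1]`; its constant extension is continuous on `ℝ`.
  refine ⟨fun s => ∫ r in (0 : ℝ)..s, Set.IccExtend zero_le_one
    ((Set.Icc (0 : ℝ) 1).domRestrict (arcIntegrand X γ)) r, by simp, ?_, fun s hs' => ?_⟩
  · refine intervalIntegral.integral_congr fun s hs' => ?_
    rw [Set.uIcc_of_le zero_le_one] at hs'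
    exact Set.IccExtend_of_mem _ _ hs'
  · have := (hG.integral_hasStrictDerivAt 0 s).hasDerivAt.hasDerivWithinAt (s := Set.Icc 0 1)
    rwa [Set.IccExtend_of_mem _ _ hs'] at this

/-- A saturated set is stable under continuation along arcs: `F - e ∘ γ` is locally constant, for
`F` the indefinite integral of `ω_X` along `γ`, so `(γ s, t + F s)` stays locally in a plaque. -/
theorem IsSaturated.arc_mem (hX : IsSingularAnalytic X) {S : Set (M × ℂ)} (hS : IsSaturated X S)
    {γ : ℝ → M} (hγ : ContMDiffOn 𝓘(ℝ, ℝ) 𝓘(ℝ, ℂ) 1 γ (Set.Icc 0 1))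
    (hs : ∀ s ∈ Set.Icc (0 : ℝ) 1, γ s ∉ singSet X) {t : ℂ} (h0 : (γ 0, t) ∈ S) :
    (γ 1, t + arcIntegral X γ) ∈ S := by
  obtain ⟨F, hF0, hF1, hF⟩ := exists_primitive_arcIntegrand hX hγ hs
  have key : ∀ s ∈ Set.Icc (0 : ℝ) 1, ∀ᶠ r in 𝓝[Set.Icc 0 1] s,
      ((γ s, t + F s) ∈ S ↔ (γ r, t + F r) ∈ S) := by
    intro s hs'
    obtain ⟨e, he, hp, -⟩ := exists_isFlowBox hX (hs s hs') 0
    obtain ⟨δ, hδ, hball⟩ := Metric.mem_nhdsWithin_iff.1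
      ((hγ s hs').continuousWithinAt (e.open_source.mem_nhds hp))
    refine Metric.mem_nhdsWithin_iff.2 ⟨δ, hδ, fun r hr => ?_⟩
    have hconv : Convex ℝ (Metric.ball s δ ∩ Set.Icc 0 1) :=
      (convex_ball s δ).inter (convex_Icc 0 1)
    have hd : ∀ x ∈ Metric.ball s δ ∩ Set.Icc 0 1,
        HasDerivWithinAt (F - e ∘ γ) 0 (Metric.ball s δ ∩ Set.Icc 0 1) x := fun x hx => by
      have := (hF x hx.2).sub (he.hasDerivWithinAt_comp (hγ x hx.2) (hball hx))
      rw [sub_self] at this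
      exact this.mono Set.inter_subset_right
    have hsm : s ∈ Metric.ball s δ ∩ Set.Icc 0 1 := ⟨Metric.mem_ball_self hδ, hs'⟩
    have hconst : F r - e (γ r) = F s - e (γ s) := by
      have := hconv.norm_image_sub_le_of_norm_hasDerivWithin_le (C := 0) hd (by simp) hsm hr
      rw [zero_mul, norm_le_zero_iff, sub_eq_zero] at this
      exact this
    have h1 : t + F s = e (γ s) + (t + (F s - e (γ s))) := by ring
    have h2 : t + F r = e (γ r) + (t + (F s - e (γ s))) := by rw [← hconst]; ring
    change (γ s, t + F s) ∈ S ↔ (γ r, t + F r) ∈ S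
    rw [h1, h2]
    exact ⟨hS e he _ _ hp _ (hball hr), hS e he _ _ (hball hr) _ hp⟩
  have := isPreconnected_Icc.induction₂ _ key (fun _ _ _ _ _ _ h1 h2 => h1.trans h2)
    (fun _ _ _ _ => Iff.symm) (Set.left_mem_Icc.2 zero_le_one) (Set.right_mem_Icc.2 zero_le_one)
  rw [← hF1]
  exact this.1 (by rwa [hF0, add_zero])

end Arcs

/-! ### Values of the distinguished parameter -/

section PsiValues

variable {X : ∀ z : M, TangentSpace 𝓘(ℂ, ℂ) z} {z₀ : M}

theorem IsPsiValue.left_not_mem {z : M} {t : ℂ} (h : IsPsiValue X z₀ z t) : z₀ ∉ singSet X := by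
  induction h with
  | base h => exact h
  | arc _ _ _ _ ih => exact ih

theorem IsPsiValue.not_mem {z : M} {t : ℂ} (h : IsPsiValue X z₀ z t) : z ∉ singSet X := by
  induction h with
  | base h => exact h
  | arc _ _ _ hs => exact hs 1 (Set.right_mem_Icc.2 zero_le_one)

theorem IsPsiValue.trans {z₁ z : M} {s t : ℂ} (h₁ : IsPsiValue X z₀ z₁ s)
    (h₂ : IsPsiValue X z₁ z t) : IsPsiValue X z₀ z (s + t) := by
  induction h₂ with
  | base h => rwa [add_zero]
  | arc γ _ hγ hs ih =>
    rw [← add_assoc]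
    exact .arc γ ih hγ hs

/-- Two points of a flow box `e` are joined by the arc which `e` maps to a segment, along which the
integral of `ω_X` is the increment of `e`. -/
theorem isSaturated_psiGraph : IsSaturated X (psiGraph X z₀) := by
  intro e he a z hz z' hz' h
  set l : ℝ → ℂ := fun s => e z + s * (e z' - e z) with hl
  have hlt : ∀ s ∈ Set.Icc (0 : ℝ) 1, l s ∈ e.target := fun s hs => by
    have := he.convex_target.add_smul_sub_mem (e.map_source hz) (e.map_source hz') hs
    simpa [hl] using this
  have hlc : ContDiff ℝ 1 l :=
    contDiff_const.add (Complex.ofRealCLM.contDiff.mul contDiff_const)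
  set γ : ℝ → M := e.symm ∘ l with hγ
  have hγs : ∀ s ∈ Set.Icc (0 : ℝ) 1, γ s ∈ e.source := fun s hs => e.map_target (hlt s hs)
  have hγd : ContMDiffOn 𝓘(ℝ, ℝ) 𝓘(ℝ, ℂ) 1 γ (Set.Icc 0 1) := fun s hs => by
    have h := contMDiffAt_restrictScalars
      (he.contMDiffOn_symm.contMDiffAt (e.open_target.mem_nhds (hlt s hs)))
    exact (h.of_le le_top).comp_contMDiffWithinAt s hlc.contMDiff.contMDiffAt.contMDiffWithinAt
  have hint : arcIntegral X γ = e z' - e z := by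
    have : ∀ s ∈ Set.uIcc (0 : ℝ) 1, arcIntegrand X γ s = e z' - e z := fun s hs => by
      rw [Set.uIcc_of_le zero_le_one] at hs
      have h1 := he.hasDerivWithinAt_comp (hγd s hs) (hγs s hs)
      have h2 : HasDerivAt l (e z' - e z) s := by
        have := ((Complex.ofRealCLM.hasDerivAt (x := s)).mul_const (e z' - e z)).const_add (e z)
        simpa [hl] using this
      refine (uniqueDiffOn_Icc zero_lt_one s hs).eq_deriv _ h1
        (h2.hasDerivWithinAt.congr_of_mem (fun r hr => ?_) hs)
      exact e.right_inv (hlt r hr)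
    calc arcIntegral X γ = ∫ s in (0 : ℝ)..1, (e z' - e z) :=
          intervalIntegral.integral_congr this
      _ = e z' - e z := by simp
  have h0 : γ 0 = z := by simp [hγ, hl, e.left_inv hz]
  have h1 : γ 1 = z' := by simp [hγ, hl, e.left_inv hz']
  have := IsPsiValue.arc (z₀ := z₀) γ (t := e z + a) (by rw [h0]; exact h) hγd
    (fun s hs => he.source_subset (hγs s hs))
  rw [h1, hint] at this
  change IsPsiValue X z₀ z' (e z' + a)
  convert this using 1
  ring

/-- The complement of a countable set in a disc is connected, since the disc is homeomorphic to the
plane. -/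
theorem isConnected_ball_diff {s : Set ℂ} (hs : s.Countable) (c : ℂ) {r : ℝ} (hr : 0 < r) :
    IsConnected (Metric.ball c r \ s) := by
  set u := OpenPartialHomeomorph.univBall c r
  have hinj : Function.Injective u := fun x y h =>
    u.injOn (by simp [u]) (by simp [u]) h
  have h1 : (u ⁻¹' s).Countable := hs.preimage hinj
  have h2 := (h1.isConnected_compl_of_one_lt_rank (by simp)).image u
    (by simpa [u] using (OpenPartialHomeomorph.continuous_univBall c r).continuousOn)
  convert h2 using 1
  have h3 : Set.range u = Metric.ball c r := by
    rw [← OpenPartialHomeomorph.univBall_target c hr, ← u.image_source_eq_target,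
      OpenPartialHomeomorph.univBall_source, Set.image_univ]
  rw [← Set.preimage_compl, Set.image_preimage_eq_inter_range, h3, Set.inter_comm, Set.sdiff_eq]

/-- Removing a countable set does not disconnect a component of a surface. -/
theorem connectedComponent_inter_subset_of_countable {s : Set M} (hs : s.Countable)
    (hz₀ : z₀ ∉ s) :
    connectedComponent z₀ ∩ sᶜ ⊆ connectedComponentIn sᶜ z₀ := by
  have hbasis : ∀ p : M, ∀ W ∈ 𝓝 p, ∃ D ⊆ W, IsOpen D ∧ p ∈ D ∧ IsConnected (D \ s) := by
    intro p W hW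
    set κ := chartAt ℂ p
    have hp : p ∈ κ.source := mem_chart_source ℂ p
    obtain ⟨r, hr, hball⟩ := Metric.mem_nhds_iff.1 (Filter.inter_mem
      (κ.open_target.mem_nhds (κ.map_source hp))
      ((κ.continuousAt_symm (κ.map_source hp)) (by rwa [κ.left_inv hp])))
    refine ⟨κ.source ∩ κ ⁻¹' Metric.ball (κ p) r, ?_,
      κ.isOpen_inter_preimage Metric.isOpen_ball, ⟨hp, Metric.mem_ball_self hr⟩, ?_⟩
    · rintro z ⟨hz, hzb⟩
      have := (hball hzb).2
      rwa [Set.mem_preimage, κ.left_inv hz] at this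
    · have h1 := (isConnected_ball_diff ((hs.mono Set.inter_subset_right).image κ :
        (κ '' (κ.source ∩ s)).Countable) (κ p) hr).image κ.symm
        (κ.continuousOn_symm.mono fun w hw => (hball hw.1).1)
      convert h1 using 1
      ext z
      constructor
      · rintro ⟨⟨hz, hzb⟩, hzs⟩
        refine ⟨κ z, ⟨hzb, ?_⟩, κ.left_inv hz⟩
        rintro ⟨z', ⟨hz', hzs'⟩, h⟩
        exact hzs (κ.injOn hz' hz h ▸ hzs')
      · rintro ⟨w, ⟨hw, hws⟩, rfl⟩
        have hwt := (hball hw).1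
        refine ⟨⟨κ.map_target hwt, by rwa [Set.mem_preimage, κ.right_inv hwt]⟩, fun h => ?_⟩
        exact hws ⟨κ.symm w, ⟨κ.map_target hwt, h⟩, κ.right_inv hwt⟩
  set A := connectedComponentIn sᶜ z₀ with hA
  have hDA : ∀ D : Set M, IsConnected (D \ s) → ∀ q ∈ D \ s, q ∈ A → D \ s ⊆ A :=
    fun D hD q hq hqA => by
      rw [hA, connectedComponentIn_eq hqA]
      exact hD.isPreconnected.subset_connectedComponentIn hq fun _ h => h.2
  -- The points near which everything outside of `s` lies in the component of `z₀` form an open and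
  -- closed set.
  have hopen : ∀ p : M, ∀ᶠ q in 𝓝 p,
      ((∀ᶠ q' in 𝓝 p, q' ∉ s → q' ∈ A) ↔ ∀ᶠ q' in 𝓝 q, q' ∉ s → q' ∈ A) := by
    intro p
    obtain ⟨D, -, hDo, hpD, hDc⟩ := hbasis p Set.univ Filter.univ_mem
    have hD : ∀ q ∈ D, ∀ q' ∈ D, (∀ᶠ x in 𝓝 q, x ∉ s → x ∈ A) → ∀ᶠ x in 𝓝 q', x ∉ s → x ∈ A := by
      intro q hq q' hq' h
      obtain ⟨D', hD'W, -, -, hD'c⟩ := hbasis q _ (Filter.inter_mem h (hDo.mem_nhds hq))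
      obtain ⟨y, hyD', hys⟩ := hD'c.nonempty
      have hsub := hDA D hDc y ⟨(hD'W hyD').2, hys⟩ ((hD'W hyD').1 hys)
      filter_upwards [hDo.mem_nhds hq'] with x hx hxs using hsub ⟨hx, hxs⟩
    filter_upwards [hDo.mem_nhds hpD] with q hq
    exact ⟨hD p hpD q hq, hD q hq p hpD⟩
  rintro p ⟨hp, hps⟩
  have := (isPreconnected_connectedComponent (x := z₀)).induction₂ _
    (fun x _ => mem_nhdsWithin_of_mem_nhds (hopen x))
    (fun _ _ _ _ _ _ h1 h2 => h1.trans h2) (fun _ _ _ _ => Iff.symm) mem_connectedComponent hp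
  refine (this.1 ?_).self_of_nhds hps
  obtain ⟨D, -, hDo, hpD, hDc⟩ := hbasis z₀ Set.univ Filter.univ_mem
  have hsub := hDA D hDc z₀ ⟨hpD, hz₀⟩ (mem_connectedComponentIn hz₀)
  filter_upwards [hDo.mem_nhds hpD] with x hx hxs using hsub ⟨hx, hxs⟩

variable [IsManifold 𝓘(ℂ, ℂ) ω M]

/-- The graph of `Ψ_X` is contained in every saturated set through `(z₀, 0)`. -/
theorem IsPsiValue.mem_of_isSaturated (hX : IsSingularAnalytic X) {S : Set (M × ℂ)}
    (hS : IsSaturated X S) (h0 : (z₀, 0) ∈ S) {z : M} {t : ℂ} (h : IsPsiValue X z₀ z t) :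
    (z, t) ∈ S := by
  induction h with
  | base h => exact h0
  | arc γ _ hγ hs ih => exact hS.arc_mem hX hγ hs ih

/-- The points `(z, t)` such that `-t` is a value at `z₀` of the distinguished parameter with
initial point `z` form a saturated set; no reversal of arcs is needed. -/
theorem IsPsiValue.symm (hX : IsSingularAnalytic X) {z : M} {t : ℂ} (h : IsPsiValue X z₀ z t) :
    IsPsiValue X z z₀ (-t) := by
  refine h.mem_of_isSaturated (S := {q | IsPsiValue X q.1 z₀ (-q.2)}) hX ?_
    (by simpa using IsPsiValue.base h.left_not_mem)
  intro e he a z hz z' hz' h'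
  have h1 : IsPsiValue X z' z (e z + -e z') :=
    isSaturated_psiGraph e he (-e z') z' hz' z hz
      (by rw [add_neg_cancel]; exact IsPsiValue.base (he.source_subset hz'))
  have := h1.trans h'
  change IsPsiValue X z' z₀ (-(e z' + a))
  convert this using 1
  ring

theorem psiGraph_eq_image (hX : IsSingularAnalytic X) {z₁ : M} {c : ℂ} (h : IsPsiValue X z₀ z₁ c) :
    psiGraph X z₀ = (fun q : M × ℂ => (q.1, q.2 + c)) '' psiGraph X z₁ := by
  ext ⟨z, t⟩
  constructor
  · intro hz
    refine ⟨(z, -c + t), (h.symm hX).trans hz, ?_⟩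
    simp
  · rintro ⟨⟨z', t'⟩, hz, he⟩
    obtain ⟨rfl, rfl⟩ := Prod.mk.inj he
    have := h.trans hz
    rwa [add_comm] at this

theorem exists_isPsiValue (hX : IsSingularAnalytic X) {z₁ : M}
    (hz₁ : z₁ ∈ connectedComponentIn (singSet X)ᶜ z₀) : ∃ c : ℂ, IsPsiValue X z₀ z₁ c := by
  have hz₀ : z₀ ∈ (singSet X)ᶜ := by
    by_contra h
    rw [connectedComponentIn_eq_empty h] at hz₁
    exact hz₁
  have hsub := connectedComponentIn_subset (singSet X)ᶜ z₀
  refine isPreconnected_connectedComponentIn.induction₂ (fun z z' => ∃ c, IsPsiValue X z z' c)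
    (fun z hz => ?_) (fun _ _ _ _ _ _ ⟨c, h1⟩ ⟨c', h2⟩ => ⟨c + c', h1.trans h2⟩)
    (fun _ _ _ _ ⟨c, h⟩ => ⟨-c, h.symm hX⟩) (mem_connectedComponentIn hz₀) hz₁
  obtain ⟨e, he, hze, h0⟩ := exists_isFlowBox hX (hsub hz) 0
  refine Filter.mem_of_superset (mem_nhdsWithin_of_mem_nhds (e.open_source.mem_nhds hze))
    fun z' hz' => ⟨e z' + 0, isSaturated_psiGraph e he 0 z hze z' hz' ?_⟩
  rw [h0, add_zero]
  exact IsPsiValue.base (hsub hz)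

end PsiValues

/-! ### Local biholomorphisms, and maps with `dG = X(G) dq` -/

section FlowMaps

section LocalHomeomorph

variable {Y : Type v} [TopologicalSpace Y] {p : Y → ℂ}

/-- The complex structure which makes a local homeomorphism `p` to the plane a local coordinate at
every point: the charts are the homeomorphisms between open sets that are given by `p`. -/
abbrev chartedSpaceOfIsLocalHomeomorph (hp : IsLocalHomeomorph p) : ChartedSpace ℂ Y where
  atlas := {E | p = E}
  chartAt y := (hp y).choose
  mem_chart_source y := (hp y).choose_spec.1
  chart_mem_atlas y := (hp y).choose_spec.2

theorem isManifold_of_isLocalHomeomorph (hp : IsLocalHomeomorph p) :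
    letI := chartedSpaceOfIsLocalHomeomorph hp
    IsManifold 𝓘(ℂ, ℂ) ω Y := by
  let := chartedSpaceOfIsLocalHomeomorph hp
  refine isManifold_of_contDiffOn 𝓘(ℂ, ℂ) ω Y fun E E' hE hE' => ?_
  refine contDiffOn_id.congr fun t ht => ?_
  have ht' : t ∈ E.target := by
    simp only [mfld_simps] at ht
    exact ht.1
  have h1 : p = E := hE
  have h2 : p = E' := hE'
  change E' (E.symm t) = t
  rw [← h2, h1, E.right_inv ht']

theorem isLocalDiffeomorph_of_isLocalHomeomorph (hp : IsLocalHomeomorph p) :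
    letI := chartedSpaceOfIsLocalHomeomorph hp
    IsLocalDiffeomorph 𝓘(ℂ, ℂ) 𝓘(ℂ, ℂ) ω p := by
  let := chartedSpaceOfIsLocalHomeomorph hp
  have := isManifold_of_isLocalHomeomorph hp
  intro y
  have hy : p = chartAt ℂ y := (hp y).choose_spec.2
  refine ⟨⟨(chartAt ℂ y).toPartialEquiv, (chartAt ℂ y).open_source, (chartAt ℂ y).open_target,
    contMDiffOn_chart, contMDiffOn_chart_symm⟩, mem_chart_source ℂ y, fun x _ => ?_⟩
  exact congrFun hy x

end LocalHomeomorph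

section FlowMap

variable {X : ∀ z : M, TangentSpace 𝓘(ℂ, ℂ) z}
variable {Z : Type v} [TopologicalSpace Z] [ChartedSpace ℂ Z]

/-- A continuous map is holomorphic if it is so after composition with a local biholomorphism. -/
theorem contMDiff_of_comp_isLocalDiffeomorph {Y : Type*} [TopologicalSpace Y] [ChartedSpace ℂ Y]
    {p : Y → ℂ} (hp : IsLocalDiffeomorph 𝓘(ℂ, ℂ) 𝓘(ℂ, ℂ) ω p) {h : Z → Y} (hc : Continuous h)
    (hs : ContMDiff 𝓘(ℂ, ℂ) 𝓘(ℂ, ℂ) ω (p ∘ h)) : ContMDiff 𝓘(ℂ, ℂ) 𝓘(ℂ, ℂ) ω h := by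
  intro z
  refine ((hp (h z)).localInverse_contMDiffAt.comp z (hs z)).congr_of_eventuallyEq ?_
  filter_upwards [hc.continuousAt.eventually (hp (h z)).localInverse_eventuallyEq_left] with z' hz'
  exact hz'.symm

theorem eventually_eq_of_hasMFDerivAt_zero [IsManifold 𝓘(ℂ, ℂ) ω Z] {u : Z → ℂ} {z₀ : Z}
    (h : ∀ᶠ z in 𝓝 z₀, HasMFDerivAt 𝓘(ℂ, ℂ) 𝓘(ℂ, ℂ) u z (0 : ℂ →L[ℂ] ℂ)) :
    ∀ᶠ z in 𝓝 z₀, u z = u z₀ := by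
  have := isManifold_one (M := Z)
  set κ := chartAt ℂ z₀
  have hz : z₀ ∈ κ.source := mem_chart_source ℂ z₀
  obtain ⟨r, hr, hball⟩ := Metric.mem_nhds_iff.1 (Filter.inter_mem
    (κ.open_target.mem_nhds (κ.map_source hz))
    ((κ.continuousAt_symm (κ.map_source hz)) (by rwa [κ.left_inv hz])))
  have hd : ∀ w ∈ Metric.ball (κ z₀) r,
      HasDerivWithinAt (u ∘ κ.symm) 0 (Metric.ball (κ z₀) r) w := by
    intro w hw
    have h1 : HasMFDerivAt 𝓘(ℂ, ℂ) 𝓘(ℂ, ℂ) u (κ.symm w) (0 : ℂ →L[ℂ] ℂ) := (hball hw).2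
    have h2 := h1.comp w
      (mdifferentiableAt_atlas_symm (chart_mem_atlas ℂ z₀) (hball hw).1).hasMFDerivAt
    have h3 : HasFDerivAt (u ∘ κ.symm) (_ : ℂ →L[ℂ] ℂ) w := hasMFDerivAt_iff_hasFDerivAt.1 h2
    exact h3.hasDerivAt.hasDerivWithinAt
  filter_upwards [κ.open_source.mem_nhds hz, (κ.continuousAt hz) (Metric.ball_mem_nhds _ hr)]
    with z h1 h2
  have := (convex_ball (κ z₀) r).norm_image_sub_le_of_norm_hasDerivWithin_le (C := 0) hd (by simp)
    (Metric.mem_ball_self hr) h2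
  rw [zero_mul, norm_le_zero_iff, sub_eq_zero] at this
  simpa [κ.left_inv h1, κ.left_inv hz] using this

/-- The maps `G : Z → M` and `q : Z → ℂ` satisfy `dG = X(G) dq` at `z`: in terms of the time `q`,
`G` moves along the flow of `X`. The map `q` is not required to be a local coordinate, so this makes
sense for analytic continuations and for integral manifolds of the suspension alike. -/
def IsFlowMapAt (X : ∀ z : M, TangentSpace 𝓘(ℂ, ℂ) z) (G : Z → M) (q : Z → ℂ) (z : Z) : Prop :=
  ∃ a : TangentSpace 𝓘(ℂ, ℂ) z →L[ℂ] ℂ, HasMFDerivAt 𝓘(ℂ, ℂ) 𝓘(ℂ, ℂ) q z a ∧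
    HasMFDerivAt 𝓘(ℂ, ℂ) 𝓘(ℂ, ℂ) G z ((ContinuousLinearMap.toSpanSingleton ℂ (X (G z))).comp a)

theorem IsFlowMapAt.congr {G G' : Z → M} {q q' : Z → ℂ} {z : Z} (h : IsFlowMapAt X G q z)
    (hG : G' =ᶠ[𝓝 z] G) (hq : q' =ᶠ[𝓝 z] q) : IsFlowMapAt X G' q' z := by
  obtain ⟨a, h1, h2⟩ := h
  refine ⟨a, h1.congr_of_eventuallyEq hq, (h2.congr_of_eventuallyEq hG).congr_mfderiv
    (ContinuousLinearMap.ext fun v => ?_)⟩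
  have key (Y : M → ℂ) (z z' : M) (hz : z = z') (c : ℂ) : c * Y z = c * Y z' := by rw [hz]
  exact key X _ _ hG.eq_of_nhds.symm (a v)

theorem IsFlowMapAt.comp {G : ℂ → M} {q : Z → ℂ} {z : Z} (h : IsFlowMapAt X G id (q z))
    (hq : MDifferentiableAt 𝓘(ℂ, ℂ) 𝓘(ℂ, ℂ) q z) : IsFlowMapAt X (G ∘ q) q z := by
  obtain ⟨a, h1, h2⟩ := h
  have ha : a = ContinuousLinearMap.id ℂ ℂ := hasMFDerivAt_unique h1 (hasMFDerivAt_id _)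
  refine ⟨_, hq.hasMFDerivAt, (h2.comp z hq.hasMFDerivAt).congr_mfderiv ?_⟩
  rw [ha]
  rfl

/-- A primitive `ψ` of `ω_X` measures time along `G`: `d(ψ ∘ G) = dq`. -/
theorem IsFlowMapAt.hasMFDerivAt_sub {G : Z → M} {q : Z → ℂ} {z : Z} (h : IsFlowMapAt X G q z)
    {ψ : M → ℂ} (hψ : HasMFDerivAt 𝓘(ℂ, ℂ) 𝓘(ℂ, ℂ) ψ (G z) (dualForm X (G z)))
    (hX : X (G z) ≠ 0) :
    HasMFDerivAt 𝓘(ℂ, ℂ) 𝓘(ℂ, ℂ) (ψ ∘ G - q) z (0 : ℂ →L[ℂ] ℂ) := by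
  obtain ⟨a, ha, hG⟩ := h
  refine ((hψ.comp z hG).sub ha).congr_mfderiv (ContinuousLinearMap.ext fun v => ?_)
  have key (x y : ℂ) (hx : x ≠ 0) : x⁻¹ * (y * x) - y = 0 := by field_simp; ring
  exact key (X (G z)) (a v) hX

end FlowMap

end FlowMaps

/-! ### The Riemann surface of the distinguished parameter -/

section Surface

variable {X : ∀ z : M, TangentSpace 𝓘(ℂ, ℂ) z} {z₀ : M}

namespace RSurface

theorem fst_not_mem (r : RSurface X z₀) : r.fst ∉ singSet X := r.2.not_mem

theorem ext {r r' : RSurface X z₀} (h₁ : r.fst = r'.fst) (h₂ : r.snd = r'.snd) : r = r' :=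
  Subtype.ext (Prod.ext h₁ h₂)

theorem isOpen_branch {V : Set M} (hV : IsOpen V) (hVs : V ⊆ (singSet X)ᶜ) {ψ : M → ℂ}
    (hψ : ∀ z ∈ V, HasMFDerivAt 𝓘(ℂ, ℂ) 𝓘(ℂ, ℂ) ψ z (dualForm X z)) :
    IsOpen {r : RSurface X z₀ | r.fst ∈ V ∧ r.snd = ψ r.fst} :=
  TopologicalSpace.isOpen_generateFrom_of_mem ⟨V, ψ, hV, hVs, hψ, rfl⟩

/-- A map to `R_X` whose components satisfy `dG = X(G) dq` is continuous for the topology of the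
graph, which is finer than that of `M × ℂ`: if it meets a branch `t = ψ(z)` it stays in it. -/
theorem continuousAt_of_isFlowMapAt (hX : IsSingularAnalytic X)
    {Z : Type v} [TopologicalSpace Z] [ChartedSpace ℂ Z] [IsManifold 𝓘(ℂ, ℂ) ω Z]
    {h : Z → RSurface X z₀} {z : Z} (hz : ∀ᶠ y in 𝓝 z, IsFlowMapAt X (fst ∘ h) (snd ∘ h) y) :
    ContinuousAt h z := by
  refine TopologicalSpace.tendsto_nhds_generateFrom_iff.2 ?_
  rintro _ ⟨V, ψ, hV, hVs, hψ, rfl⟩ hzV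
  obtain ⟨a, -, hG⟩ := hz.self_of_nhds
  have h1 : ∀ᶠ y in 𝓝 z, (h y).fst ∈ V := hG.continuousAt (hV.mem_nhds hzV.1)
  have h2 := eventually_eq_of_hasMFDerivAt_zero (u := ψ ∘ (fst ∘ h) - snd ∘ h) (z₀ := z) (by
    filter_upwards [h1, hz] with y hy1 hy2
    exact hy2.hasMFDerivAt_sub (hψ _ hy1) (hX _ (hVs hy1)).2)
  filter_upwards [h1, h2] with y hy1 hy2
  refine ⟨hy1, ?_⟩
  have h3 : (h z).snd = ψ (h z).fst := hzV.2
  have h4 : ψ (h y).fst - (h y).snd = ψ (h z).fst - (h z).snd := hy2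
  rw [← h3, sub_self, sub_eq_zero] at h4
  exact h4.symm

theorem isFlowMapAt_symm {e : OpenPartialHomeomorph M ℂ} (he : IsFlowBox X e) (a : ℂ) {t : ℂ}
    (ht : t ∈ e.target) : IsFlowMapAt X e.symm (fun s => s + a) t :=
  ⟨ContinuousLinearMap.id ℂ ℂ, ((hasFDerivAt_id t).add_const a).hasMFDerivAt,
    he.hasMFDerivAt_symm t ht⟩

/-- The plaque `{(e.symm t, t + a)}` through a point of `R_X` is contained in `R_X`, and it is
parametrized continuously by `t`. -/
theorem exists_continuousOn_lift (hX : IsSingularAnalytic X) (r : RSurface X z₀)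
    {e : OpenPartialHomeomorph M ℂ} (he : IsFlowBox X e) (hr : r.fst ∈ e.source) (a : ℂ)
    (hre : e r.fst + a = r.snd) :
    ∃ h : ℂ → RSurface X z₀, ContinuousOn h e.target ∧
      ∀ t ∈ e.target, (h t).fst = e.symm t ∧ (h t).snd = t + a := by
  classical
  have hmem : ∀ t ∈ e.target, (e.symm t, t + a) ∈ psiGraph X z₀ := fun t ht => by
    have h := isSaturated_psiGraph (z₀ := z₀) e he a r.fst hr (e.symm t) (e.map_target ht)
      (by rw [hre]; exact r.2)
    rwa [e.right_inv ht] at h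
  set h : ℂ → RSurface X z₀ := fun t =>
    if ht : t ∈ e.target then ⟨(e.symm t, t + a), hmem t ht⟩ else r
  have heq : ∀ t (ht : t ∈ e.target), h t = ⟨(e.symm t, t + a), hmem t ht⟩ := fun t ht =>
    dif_pos ht
  have h1 : ∀ t ∈ e.target, (h t).fst = e.symm t := fun t ht => by rw [heq t ht]; rfl
  have h2 : ∀ t ∈ e.target, (h t).snd = t + a := fun t ht => by rw [heq t ht]; rfl
  refine ⟨h, fun t ht => ?_, fun t ht => ⟨h1 t ht, h2 t ht⟩⟩
  refine (continuousAt_of_isFlowMapAt hX ?_).continuousWithinAt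
  filter_upwards [e.open_target.mem_nhds ht] with s hs
  refine (isFlowMapAt_symm he a hs).congr ?_ ?_
  · filter_upwards [e.open_target.mem_nhds hs] with s' hs' using h1 s' hs'
  · filter_upwards [e.open_target.mem_nhds hs] with s' hs' using h2 s' hs'

variable [IsManifold 𝓘(ℂ, ℂ) ω M]

theorem continuous_fst (hX : IsSingularAnalytic X) : Continuous (fst : RSurface X z₀ → M) := by
  refine continuous_iff_continuousAt.2 fun r U hU => ?_
  obtain ⟨U', hU'U, hU'o, hrU'⟩ := mem_nhds_iff.1 hU
  obtain ⟨e, he, hre, hc⟩ := exists_isFlowBox hX r.fst_not_mem r.snd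
  refine Filter.mem_map.2 (Filter.mem_of_superset ((isOpen_branch (z₀ := z₀)
    (hU'o.inter e.open_source)
    (fun z hz => he.source_subset hz.2) (ψ := e) (fun z hz => he.hasMFDerivAt z hz.2)).mem_nhds
    ⟨⟨hrU', hre⟩, hc.symm⟩) fun s hs => hU'U hs.1.1)

theorem continuous_snd (hX : IsSingularAnalytic X) : Continuous (snd : RSurface X z₀ → ℂ) := by
  refine continuous_iff_continuousAt.2 fun r => ?_
  obtain ⟨e, he, hre, hc⟩ := exists_isFlowBox hX r.fst_not_mem r.snd
  have h : ContinuousAt (e ∘ fst) r :=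
    (e.continuousAt hre).comp (continuous_fst hX).continuousAt
  refine h.congr ?_
  filter_upwards [(isOpen_branch (z₀ := z₀) e.open_source he.source_subset
    he.hasMFDerivAt).mem_nhds ⟨hre, hc.symm⟩] with s hs
  exact hs.2.symm

theorem t2Space [T2Space M] (hX : IsSingularAnalytic X) : T2Space (RSurface X z₀) :=
  .of_injective_continuous (f := fun r => (r.fst, r.snd))
    (fun _ _ h => ext (Prod.mk.inj h).1 (Prod.mk.inj h).2)
    ((continuous_fst hX).prodMk (continuous_snd hX))

/-- The plaques of `R_X` are open, and `π₂` is a homeomorphism of each onto the target of the flow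
box. -/
theorem exists_plaque (hX : IsSingularAnalytic X) (r : RSurface X z₀) :
    ∃ (e : OpenPartialHomeomorph M ℂ) (E : OpenPartialHomeomorph (RSurface X z₀) ℂ),
      IsFlowBox X e ∧ r ∈ E.source ∧ snd = E ∧ E.target = e.target ∧
      (∀ s ∈ E.source, s.fst ∈ e.source ∧ e.symm s.snd = s.fst) := by
  obtain ⟨e, he, hre, hc⟩ := exists_isFlowBox hX r.fst_not_mem r.snd
  obtain ⟨inv, hinvc, hinv⟩ := exists_continuousOn_lift hX r he hre 0 (by rw [hc, add_zero])
  have hinv1 : ∀ t ∈ e.target, (inv t).fst = e.symm t := fun t ht => (hinv t ht).1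
  have hinv2 : ∀ t ∈ e.target, (inv t).snd = t := fun t ht => by rw [(hinv t ht).2, add_zero]
  refine ⟨e, {
    toFun := snd
    invFun := inv
    source := {s | s.fst ∈ e.source ∧ s.snd = e s.fst}
    target := e.target
    map_source' := fun s hs => hs.2 ▸ e.map_source hs.1
    map_target' := fun t ht => by
      change (inv t).fst ∈ e.source ∧ (inv t).snd = e (inv t).fst
      rw [hinv1 t ht, hinv2 t ht, e.right_inv ht]
      exact ⟨e.map_target ht, rfl⟩
    left_inv' := fun s hs => by
      have ht : s.snd ∈ e.target := hs.2 ▸ e.map_source hs.1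
      refine ext ?_ (hinv2 _ ht)
      rw [hinv1 _ ht, hs.2, e.left_inv hs.1]
    right_inv' := hinv2
    open_source := isOpen_branch e.open_source he.source_subset he.hasMFDerivAt
    open_target := e.open_target
    continuousOn_toFun := (continuous_snd hX).continuousOn
    continuousOn_invFun := hinvc }, he, ⟨hre, hc.symm⟩, rfl, rfl,
    fun s hs => ⟨hs.1, by rw [hs.2, e.left_inv hs.1]⟩⟩

theorem isLocalHomeomorph_snd (hX : IsSingularAnalytic X) :
    IsLocalHomeomorph (snd : RSurface X z₀ → ℂ) := fun r => by
  obtain ⟨e, E, -, hr, hE, -⟩ := exists_plaque hX r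
  exact ⟨E, hr, hE⟩

/-- The complex structure of `R_X`, with the time coordinate `t` as local coordinate. -/
abbrev chartedSpace (hX : IsSingularAnalytic X) : ChartedSpace ℂ (RSurface X z₀) :=
  chartedSpaceOfIsLocalHomeomorph (isLocalHomeomorph_snd hX)

theorem isLocalDiffeomorph_fst (hX : IsSingularAnalytic X) :
    letI := chartedSpace (z₀ := z₀) hX
    IsLocalDiffeomorph 𝓘(ℂ, ℂ) 𝓘(ℂ, ℂ) ω (fst : RSurface X z₀ → M) := by
  let := chartedSpace (z₀ := z₀) hX
  have hs : IsLocalDiffeomorph 𝓘(ℂ, ℂ) 𝓘(ℂ, ℂ) ω (snd : RSurface X z₀ → ℂ) :=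
    isLocalDiffeomorph_of_isLocalHomeomorph (isLocalHomeomorph_snd hX)
  have := isManifold_of_isLocalHomeomorph (isLocalHomeomorph_snd (z₀ := z₀) hX)
  intro r
  obtain ⟨e, E, he, hr, hE, hEt, hEe⟩ := exists_plaque hX r
  have hE1 : ContMDiffOn 𝓘(ℂ, ℂ) 𝓘(ℂ, ℂ) ω E E.source := hE ▸ hs.contMDiff.contMDiffOn
  have hE2 : ContMDiffOn 𝓘(ℂ, ℂ) 𝓘(ℂ, ℂ) ω E.symm E.target :=
    contMDiffOn_symm_of_mem_maximalAtlas
      (IsManifold.subset_maximalAtlas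
        (show E ∈ {E' : OpenPartialHomeomorph _ _ | snd = E'} from hE))
  have hsub : E.source ⊆ (E.trans e.symm).source := fun s hs => ⟨hs, by
    change E s ∈ e.target
    rw [← hEt]; exact E.map_source hs⟩
  refine ⟨⟨(E.trans e.symm).toPartialEquiv, (E.trans e.symm).open_source,
    (E.trans e.symm).open_target, ?_, ?_⟩, hsub hr, fun s hs => ?_⟩
  · exact he.contMDiffOn_symm.comp (hE1.mono Set.inter_subset_left) Set.inter_subset_right
  · exact hE2.comp (he.contMDiffOn.mono Set.inter_subset_left) Set.inter_subset_right
  · have := (hEe s hs.1).2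
    rw [hE] at this
    exact this.symm

theorem isFlowMapAt (hX : IsSingularAnalytic X) (r : RSurface X z₀) :
    letI := chartedSpace (z₀ := z₀) hX
    IsFlowMapAt X (fst : RSurface X z₀ → M) snd r := by
  let := chartedSpace (z₀ := z₀) hX
  have hs : IsLocalDiffeomorph 𝓘(ℂ, ℂ) 𝓘(ℂ, ℂ) ω (snd : RSurface X z₀ → ℂ) :=
    isLocalDiffeomorph_of_isLocalHomeomorph (isLocalHomeomorph_snd hX)
  obtain ⟨e, E, he, hr, hE, hEt, hEe⟩ := exists_plaque hX r
  have ht : r.snd ∈ e.target := by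
    rw [← hEt, hE]; exact E.map_source hr
  have := IsFlowMapAt.comp ((isFlowMapAt_symm he 0 ht).congr .rfl (.of_eq (by ext; simp)))
    (hs.contMDiff.mdifferentiable (by simp) r)
  refine this.congr ?_ .rfl
  filter_upwards [E.open_source.mem_nhds hr] with s hs using (hEe s hs).2.symm

/-- The component of the base point is saturated, since plaques are connected; so it is all of
`R_X`. -/
theorem connectedSpace (hX : IsSingularAnalytic X) (hz₀ : z₀ ∉ singSet X) :
    ConnectedSpace (RSurface X z₀) := by
  set b := basePoint X z₀ hz₀
  have hS : IsSaturated X (incl '' connectedComponent b) := by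
    rintro e he a z hz z' hz' ⟨r, hrC, hr⟩
    obtain rfl : r.fst = z := congrArg Prod.fst hr
    obtain ⟨h, hc, hh⟩ := exists_continuousOn_lift hX r he hz a (congrArg Prod.snd hr).symm
    have hpre := he.convex_target.isPreconnected.image h hc
    have h1 : h (e r.fst) = r := ext
      ((hh _ (e.map_source hz)).1.trans (e.left_inv hz))
      ((hh _ (e.map_source hz)).2.trans (congrArg Prod.snd hr).symm)
    have h2 := hpre.subset_connectedComponent ⟨e r.fst, e.map_source hz, h1⟩
      ⟨e z', e.map_source hz', rfl⟩
    rw [← connectedComponent_eq hrC] at h2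
    exact ⟨_, h2, Prod.ext ((hh _ (e.map_source hz')).1.trans (e.left_inv hz'))
      (hh _ (e.map_source hz')).2⟩
  refine connectedSpace_iff_connectedComponent.2 ⟨b, Set.eq_univ_of_forall fun r => ?_⟩
  obtain ⟨r', hr', h⟩ := IsPsiValue.mem_of_isSaturated hX hS ⟨b, mem_connectedComponent, rfl⟩ r.2
  rwa [show r' = r from Subtype.ext h] at hr'

end RSurface

end Surface

/-! ### Continuation of flow maps -/

section Continuation

variable {X : ∀ z : M, TangentSpace 𝓘(ℂ, ℂ) z} {z₀ : M}

section Plane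

/-- Grönwall's inequality on the segments that start at the centre of a disc. -/
theorem eq_zero_of_norm_deriv_le_mul_norm {u u' : ℂ → ℂ} {c : ℂ} {r K : ℝ}
    (hu : ∀ ζ ∈ Metric.ball c r, HasDerivAt u (u' ζ) ζ) (h0 : u c = 0)
    (hb : ∀ ζ ∈ Metric.ball c r, ‖u' ζ‖ ≤ K * ‖u ζ‖) : ∀ ζ ∈ Metric.ball c r, u ζ = 0 := by
  intro ζ hζ
  have hr : 0 < r := (dist_nonneg).trans_lt hζ
  have hseg : ∀ s ∈ Set.Icc (0 : ℝ) 1, c + s * (ζ - c) ∈ Metric.ball c r := fun s hs => by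
    simpa using (convex_ball c r).add_smul_sub_mem (Metric.mem_ball_self hr) hζ hs
  have hd : ∀ s ∈ Set.Icc (0 : ℝ) 1, HasDerivAt (fun s : ℝ => u (c + s * (ζ - c)))
      (u' (c + s * (ζ - c)) * (ζ - c)) s := fun s hs => by
    have h1 : HasDerivAt (fun s : ℝ => c + s * (ζ - c)) (ζ - c) s := by
      simpa using ((Complex.ofRealCLM.hasDerivAt (x := s)).mul_const (ζ - c)).const_add c
    exact (hu _ (hseg s hs)).comp_of_eq s h1 rfl
  have := eq_zero_of_abs_deriv_le_mul_abs_self_of_eq_zero_right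
    (f := fun s : ℝ => u (c + s * (ζ - c))) (a := 0) (b := 1) (K := K * ‖ζ - c‖)
    (fun s hs => (hd s hs).continuousAt.continuousWithinAt)
    (fun s hs => (hd s (Set.Ico_subset_Icc_self hs)).hasDerivWithinAt) (by simpa using h0)
    (fun s hs => by
      rw [norm_mul, mul_right_comm]
      exact mul_le_mul_of_nonneg_right (hb _ (hseg s (Set.Ico_subset_Icc_self hs)))
        (norm_nonneg _)) 1 (Set.right_mem_Icc.2 zero_le_one)
  simpa using this

theorem eventually_eventually_eq_zero_iff {D : ℂ → ℂ} {ζ₀ : ℂ} (hD : AnalyticAt ℂ D ζ₀) :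
    ∀ᶠ ζ in 𝓝 ζ₀, ((∀ᶠ w in 𝓝 ζ₀, D w = 0) ↔ ∀ᶠ w in 𝓝 ζ, D w = 0) := by
  rcases hD.eventually_eq_zero_or_eventually_ne_zero with h | h
  · filter_upwards [h.eventually_nhds] with ζ hζ using iff_of_true h hζ
  · have h' := eventually_nhdsWithin_iff.1 h
    have hn : ∀ᶠ ζ in 𝓝 ζ₀, ¬ ∀ᶠ w in 𝓝 ζ, D w = 0 := by
      filter_upwards [h'.eventually_nhds] with ζ hζ hζ0
      have h1 : ∀ᶠ w in 𝓝[≠] ζ, w = ζ₀ := by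
        filter_upwards [nhdsWithin_le_nhds hζ, nhdsWithin_le_nhds hζ0] with w h1 h2
        by_contra h3
        exact h1 h3 h2
      have h2 : ∀ᶠ w in 𝓝[≠] ζ, w ≠ ζ₀ := by
        by_cases hz : ζ = ζ₀
        · rw [hz]; exact self_mem_nhdsWithin
        · exact nhdsWithin_le_nhds (isOpen_ne.mem_nhds hz)
      obtain ⟨w, h3, h4⟩ := (h1.and h2).exists
      exact h4 h3
    filter_upwards [hn] with ζ hζ using iff_of_false hn.self_of_nhds hζ

end Plane

theorem isOpen_starSet [T2Space M] : IsOpen (starSet X) := by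
  refine isOpen_iff_mem_nhds.2 fun p hp => ?_
  have hp1 : p ∉ poleSet X ∪ essentialSet X := fun h => hp (Or.inl h)
  have hp2 : p ∉ derivedSet (zeroSet X ∪ poleSet X ∪ essentialSet X) := fun h => hp (Or.inr h)
  have h1 : ∀ᶠ q in 𝓝[≠] p, q ∉ zeroSet X ∪ poleSet X ∪ essentialSet X := by
    rw [mem_derivedSet, accPt_iff_frequently_nhdsNE, Filter.not_frequently] at hp2
    exact hp2
  filter_upwards [eventually_nhdsWithin_iff.1 h1,
    (isClosed_derivedSet (zeroSet X ∪ poleSet X ∪ essentialSet X)).isOpen_compl.mem_nhds hp2]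
    with q hq hq2 hq3
  rcases hq3 with hq3 | hq3
  · by_cases hqp : q = p
    · exact hp1 (hqp ▸ hq3)
    · refine hq hqp ?_
      rw [Set.union_assoc]
      exact Or.inr hq3
  · exact hq2 hq3

theorem compl_singSet_subset_starSet : (singSet X)ᶜ ⊆ starSet X := by
  refine Set.compl_subset_compl.2 (Set.union_subset ?_ (derivedSet_subset_closure _))
  refine Set.Subset.trans ?_ subset_closure
  rw [Set.union_assoc]
  exact Set.subset_union_right

theorem mem_zeroSet_of_mem_starSet {p : M} (hp : p ∈ starSet X) (hs : p ∈ singSet X) :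
    p ∈ zeroSet X := by
  rw [singSet, closure_eq_self_union_derivedSet] at hs
  rcases hs with ((hs | hs) | hs) | hs
  · exact hs
  · exact absurd (Or.inl (Or.inl hs)) hp
  · exact absurd (Or.inl (Or.inr hs)) hp
  · exact absurd (Or.inr hs) hp

theorem analyticAt_coeff (hX : IsSingularAnalytic X) {p : M} (hp : p ∈ starSet X) :
    AnalyticAt ℂ (coeff X p) (chartAt ℂ p p) := by
  by_cases hs : p ∈ singSet X
  · exact (mem_zeroSet_of_mem_starSet hp hs).1
  · exact (hX p hs).1

section Coordinates

variable [IsManifold 𝓘(ℂ, ℂ) ω M]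
variable {Z : Type v} [TopologicalSpace Z] [ChartedSpace ℂ Z] [IsManifold 𝓘(ℂ, ℂ) ω Z]
  {G : Z → M} {q : Z → ℂ}

/-- The relation `dG = X(G) dq` in coordinates: it says that `g' = f(g) k'`, where `g` and `k` are
`G` and `q` in the chosen charts (differentiable, as the first part records) and `f` is the
coefficient of `X`. -/
theorem isFlowMapAt_iff_deriv {z y : Z} {p : M}
    (hy : y ∈ (chartAt ℂ z).source) (hyp : G y ∈ (chartAt ℂ p).source)
    (hG : MDifferentiableAt 𝓘(ℂ, ℂ) 𝓘(ℂ, ℂ) G y) (hq : MDifferentiableAt 𝓘(ℂ, ℂ) 𝓘(ℂ, ℂ) q y) :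
    (DifferentiableAt ℂ (chartAt ℂ p ∘ G ∘ (chartAt ℂ z).symm) (chartAt ℂ z y) ∧
    DifferentiableAt ℂ (q ∘ (chartAt ℂ z).symm) (chartAt ℂ z y)) ∧
    (IsFlowMapAt X G q y ↔
      deriv (chartAt ℂ p ∘ G ∘ (chartAt ℂ z).symm) (chartAt ℂ z y) -
        coeff X p (chartAt ℂ p (G y)) * deriv (q ∘ (chartAt ℂ z).symm) (chartAt ℂ z y) = 0) := by
  have := isManifold_one (M := M)
  have := isManifold_one (M := Z)
  set κ := chartAt ℂ z
  obtain ⟨ζ, hζ, rfl⟩ : ∃ ζ ∈ κ.target, κ.symm ζ = y := ⟨κ y, κ.map_source hy, κ.left_inv hy⟩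
  rw [κ.right_inv hζ, coeff_chartAt hyp]
  set T := mfderiv 𝓘(ℂ, ℂ) 𝓘(ℂ, ℂ) κ.symm ζ
  set L := mfderiv 𝓘(ℂ, ℂ) 𝓘(ℂ, ℂ) (chartAt ℂ p) (G (κ.symm ζ))
  have hT : HasMFDerivAt 𝓘(ℂ, ℂ) 𝓘(ℂ, ℂ) κ.symm ζ T :=
    (mdifferentiableAt_atlas_symm (chart_mem_atlas ℂ z) hζ).hasMFDerivAt
  have hTinj : Function.Injective T := (mdifferentiable_chart z).symm.mfderiv_injective hζ
  have hL : HasMFDerivAt 𝓘(ℂ, ℂ) 𝓘(ℂ, ℂ) (chartAt ℂ p) _ L := hasMFDerivAt_chartAt hyp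
  have hLinj : Function.Injective L := (mdifferentiable_chart p).mfderiv_injective hyp
  have hqT : HasFDerivAt (q ∘ κ.symm) (_ : ℂ →L[ℂ] ℂ) ζ :=
    hasMFDerivAt_iff_hasFDerivAt.1 (HasMFDerivAt.comp ζ hq.hasMFDerivAt hT)
  have hGT : HasFDerivAt (chartAt ℂ p ∘ G ∘ κ.symm) (_ : ℂ →L[ℂ] ℂ) ζ :=
    hasMFDerivAt_iff_hasFDerivAt.1 (HasMFDerivAt.comp ζ hL (HasMFDerivAt.comp ζ hG.hasMFDerivAt hT))
  refine ⟨⟨hGT.differentiableAt, hqT.differentiableAt⟩, ?_⟩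
  rw [hqT.hasDerivAt.deriv, hGT.hasDerivAt.deriv]
  have key (L A T a : ℂ →L[ℂ] ℂ) (x : ℂ) (hL : Function.Injective L) (hT : Function.Injective T) :
      A = (ContinuousLinearMap.toSpanSingleton ℂ x).comp a ↔
        L (A (T 1)) - L x * a (T 1) = 0 := by
    have h1 (B : ℂ →L[ℂ] ℂ) (y : ℂ) : B y = y * B 1 := by
      rw [← smul_eq_mul, ← map_smul, smul_eq_mul, mul_one]
    have hL1 : L 1 ≠ 0 := fun h => one_ne_zero (hL (h.trans (map_zero L).symm))
    have hT1 : T 1 ≠ 0 := fun h => one_ne_zero (hT (h.trans (map_zero T).symm))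
    rw [h1 L x, h1 A, h1 a, h1 L]
    constructor
    · intro h
      rw [h]
      simp
      ring
    · intro h
      ext
      have h2 : T 1 * L 1 * (A 1 - x * a 1) = 0 := by rw [← h]; ring
      have h3 := (mul_eq_zero.1 h2).resolve_left (mul_ne_zero hT1 hL1)
      simpa [mul_comm, sub_eq_zero] using h3
  refine Iff.trans ?_ (key L (mfderiv 𝓘(ℂ, ℂ) 𝓘(ℂ, ℂ) G (κ.symm ζ)) T
    (mfderiv 𝓘(ℂ, ℂ) 𝓘(ℂ, ℂ) q (κ.symm ζ)) (X (G (κ.symm ζ))) hLinj hTinj)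
  constructor
  · rintro ⟨a, ha, hGa⟩
    have e1 := hasMFDerivAt_unique ha hq.hasMFDerivAt
    have e2 := hasMFDerivAt_unique hGa hG.hasMFDerivAt
    rw [← e1]
    exact e2.symm
  · intro h
    exact ⟨_, hq.hasMFDerivAt, hG.hasMFDerivAt.congr_mfderiv h⟩

/-- Identity theorem: on a connected Riemann surface, the relation `dG = X(G) dq` propagates from
the neighbourhood of one point, because `g' - f(g) k'` is analytic in local coordinates as long as
`G` takes values in `M*`. -/
theorem isFlowMapAt_of_eventually [PreconnectedSpace Z] (hX : IsSingularAnalytic X)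
    (hG : ContMDiff 𝓘(ℂ, ℂ) 𝓘(ℂ, ℂ) ω G) (hq : ContMDiff 𝓘(ℂ, ℂ) 𝓘(ℂ, ℂ) ω q)
    (hmem : ∀ z, G z ∈ starSet X) {c : Z} (hc : ∀ᶠ z in 𝓝 c, IsFlowMapAt X G q z) (z : Z) :
    IsFlowMapAt X G q z := by
  have hstep : ∀ z : Z, ∀ᶠ z' in 𝓝 z,
      ((∀ᶠ y in 𝓝 z, IsFlowMapAt X G q y) ↔ ∀ᶠ y in 𝓝 z', IsFlowMapAt X G q y) := by
    intro z
    set κ := chartAt ℂ z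
    set χ := chartAt ℂ (G z)
    have hz : z ∈ κ.source := mem_chart_source ℂ z
    set D : ℂ → ℂ := fun ζ => deriv (χ ∘ G ∘ κ.symm) ζ -
      coeff X (G z) ((χ ∘ G ∘ κ.symm) ζ) * deriv (q ∘ κ.symm) ζ
    have hsymm : ContMDiffAt 𝓘(ℂ, ℂ) 𝓘(ℂ, ℂ) ω κ.symm (κ z) :=
      (contMDiffOn_chart_symm (x := z)).contMDiffAt (κ.open_target.mem_nhds (κ.map_source hz))
    have hinv : κ.symm (κ z) = z := κ.left_inv hz
    have hχ : ContMDiffAt 𝓘(ℂ, ℂ) 𝓘(ℂ, ℂ) ω χ (G z) :=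
      (contMDiffOn_chart (x := G z)).contMDiffAt (χ.open_source.mem_nhds (mem_chart_source ℂ _))
    have h1 : AnalyticAt ℂ (χ ∘ G ∘ κ.symm) (κ z) := by
      rw [← analyticWithinAt_univ, ← contDiffWithinAt_omega_iff_analyticWithinAt,
        contDiffWithinAt_univ, ← contMDiffAt_iff_contDiffAt]
      exact (hχ.comp_of_eq (x := κ z) ((hG _).comp _ hsymm) (by simp [hinv]))
    have h2 : AnalyticAt ℂ (q ∘ κ.symm) (κ z) := by
      rw [← analyticWithinAt_univ, ← contDiffWithinAt_omega_iff_analyticWithinAt,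
        contDiffWithinAt_univ, ← contMDiffAt_iff_contDiffAt]
      exact (hq _).comp _ hsymm
    have hD : AnalyticAt ℂ D (κ z) :=
      h1.deriv.sub (((analyticAt_coeff hX (hmem z)).comp_of_eq h1 (by simp [hinv, χ])).mul h2.deriv)
    have hiff : ∀ᶠ y in 𝓝 z, (IsFlowMapAt X G q y ↔ D (κ y) = 0) := by
      filter_upwards [κ.open_source.mem_nhds hz,
        hG.continuous.continuousAt.eventually (χ.open_source.mem_nhds (mem_chart_source ℂ _))]
        with y hy hy2
      rw [(isFlowMapAt_iff_deriv hy hy2 (hG.mdifferentiable (by simp) y)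
        (hq.mdifferentiable (by simp) y)).2]
      simp only [D, Function.comp_apply, κ.left_inv hy, κ, χ]
    have hnhds : ∀ᶠ y in 𝓝 z, ((∀ᶠ y' in 𝓝 y, IsFlowMapAt X G q y') ↔
        ∀ᶠ w in 𝓝 (κ y), D w = 0) := by
      filter_upwards [κ.open_source.mem_nhds hz, hiff.eventually_nhds] with y hy hy2
      rw [← κ.map_nhds_eq hy, Filter.eventually_map]
      exact Filter.eventually_congr hy2
    filter_upwards [hnhds, (κ.continuousAt hz).eventually (eventually_eventually_eq_zero_iff hD)]
      with y hy1 hy2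
    rw [hy1, ← hy2]
    exact hnhds.self_of_nhds
  have := isPreconnected_univ.induction₂ _ (fun x _ => mem_nhdsWithin_of_mem_nhds (hstep x))
    (fun _ _ _ _ _ _ h1 h2 => h1.trans h2) (fun _ _ _ _ => Iff.symm)
    (Set.mem_univ c) (Set.mem_univ z)
  exact (this.1 hc).self_of_nhds

/-- Uniqueness at an equilibrium: a solution of `dG = X(G) dq` through a zero of `X` is locally
constant. In coordinates `|f(w)| ≤ C |w - w₀|` near the zero `w₀`, so that `g - w₀` satisfies the
hypothesis of Grönwall's inequality. -/
theorem eventually_eq_of_mem_zeroSet {z : Z} (hflow : ∀ᶠ y in 𝓝 z, IsFlowMapAt X G q y)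
    (hz : G z ∈ zeroSet X) : ∀ᶠ y in 𝓝 z, G y = G z := by
  set κ := chartAt ℂ z
  set χ := chartAt ℂ (G z)
  have hzκ : z ∈ κ.source := mem_chart_source ℂ z
  have hzχ : G z ∈ χ.source := mem_chart_source ℂ _
  have hinv : κ.symm (κ z) = z := κ.left_inv hzκ
  set g := χ ∘ G ∘ κ.symm
  set k := q ∘ κ.symm
  have hg0 : g (κ z) = χ (G z) := by simp [g, hinv]
  have hGc : ContinuousAt G z := hflow.self_of_nhds.choose_spec.2.continuousAt
  have hode : ∀ᶠ y in 𝓝 z, DifferentiableAt ℂ k (κ y) ∧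
      HasDerivAt g (coeff X (G z) (g (κ y)) * deriv k (κ y)) (κ y) := by
    filter_upwards [κ.open_source.mem_nhds hzκ, hGc.eventually (χ.open_source.mem_nhds hzχ), hflow]
      with y hy hy2 hy3
    have h := isFlowMapAt_iff_deriv (X := X) hy hy2 hy3.choose_spec.2.mdifferentiableAt
      hy3.choose_spec.1.mdifferentiableAt
    refine ⟨h.1.2, ?_⟩
    have h2 := h.1.1.hasDerivAt
    rw [sub_eq_zero.1 (h.2.1 hy3)] at h2
    simpa only [g, Function.comp_apply, κ.left_inv hy] using h2
  have hsymm : Filter.Tendsto κ.symm (𝓝 (κ z)) (𝓝 z) := by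
    simpa only [ContinuousAt, hinv] using κ.continuousAt_symm (κ.map_source hzκ)
  have hode' : ∀ᶠ ζ in 𝓝 (κ z), DifferentiableAt ℂ k ζ ∧
      HasDerivAt g (coeff X (G z) (g ζ) * deriv k ζ) ζ := by
    filter_upwards [hsymm.eventually hode,
      κ.open_target.mem_nhds (κ.map_source hzκ)] with ζ h1 h2
    rwa [κ.right_inv h2] at h1
  obtain ⟨C, hC⟩ := hz.1.differentiableAt.hasDerivAt.isBigO_sub.bound
  rw [hz.2.1] at hC
  have hgc : ContinuousAt g (κ z) := hode'.self_of_nhds.2.continuousAt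
  have hkc : ContinuousAt (deriv k) (κ z) :=
    (Complex.analyticAt_iff_eventually_differentiableAt.2
      (hode'.mono fun _ h => h.1)).deriv.continuousAt
  have hk : ∀ᶠ ζ in 𝓝 (κ z), ‖deriv k ζ‖ < ‖deriv k (κ z)‖ + 1 :=
    hkc.norm.eventually_lt_const (lt_add_one _)
  rw [← hg0] at hC
  obtain ⟨r, hr, hball⟩ := Metric.mem_nhds_iff.1 ((hode'.and (hgc.eventually hC)).and hk)
  have hu := eq_zero_of_norm_deriv_le_mul_norm (u := fun ζ => g ζ - g (κ z))
    (u' := fun ζ => coeff X (G z) (g ζ) * deriv k ζ) (c := κ z) (r := r)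
    (K := C * (‖deriv k (κ z)‖ + 1)) (fun ζ hζ => (hball hζ).1.1.2.sub_const _) (sub_self _)
    (fun ζ hζ => by
      have h1 : ‖coeff X (G z) (g ζ)‖ ≤ C * ‖g ζ - g (κ z)‖ := by simpa using (hball hζ).1.2
      rw [norm_mul, mul_right_comm]
      exact mul_le_mul h1 (hball hζ).2.le (norm_nonneg _) ((norm_nonneg _).trans h1))
  filter_upwards [κ.open_source.mem_nhds hzκ, hGc.eventually (χ.open_source.mem_nhds hzχ),
    (κ.continuousAt hzκ).eventually (Metric.ball_mem_nhds _ hr)] with y hy hy2 hy3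
  have h1 := sub_eq_zero.1 (hu _ hy3)
  rw [hg0] at h1
  simp only [g, Function.comp_apply, κ.left_inv hy] at h1
  exact χ.injOn hy2 hzχ h1

/-- A solution of `dG = X(G) dq` with values in `M*` that meets `R_X` stays in `R_X`; in particular
it never reaches a zero of `X`. -/
theorem mem_psiGraph_of_isFlowMapAt [PreconnectedSpace Z] (hX : IsSingularAnalytic X)
    (hflow : ∀ z, IsFlowMapAt X G q z) (hmem : ∀ z, G z ∈ starSet X)
    {c : Z} (hc : (G c, q c) ∈ psiGraph X z₀) (z : Z) : (G z, q z) ∈ psiGraph X z₀ := by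
  have hcont : ∀ z, ContinuousAt G z := fun z => (hflow z).choose_spec.2.continuousAt
  have hstep : ∀ z : Z, ∀ᶠ z' in 𝓝 z,
      ((G z, q z) ∈ psiGraph X z₀ ↔ (G z', q z') ∈ psiGraph X z₀) := by
    intro z
    by_cases hz : G z ∈ singSet X
    · filter_upwards [eventually_eq_of_mem_zeroSet (.of_forall hflow)
        (mem_zeroSet_of_mem_starSet (hmem z) hz)] with z' hz'
      exact iff_of_false (fun h => IsPsiValue.not_mem h hz)
        (fun h => IsPsiValue.not_mem h (hz' ▸ hz))
    · obtain ⟨e, he, hze, h0⟩ := exists_isFlowBox hX hz (q z)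
      have h1 : ∀ᶠ z' in 𝓝 z, G z' ∈ e.source := hcont z (e.open_source.mem_nhds hze)
      have h2 := eventually_eq_of_hasMFDerivAt_zero (u := e ∘ G - q) (z₀ := z) (by
        filter_upwards [h1] with y hy
        exact (hflow y).hasMFDerivAt_sub (he.hasMFDerivAt _ hy) (hX _ (he.source_subset hy)).2)
      filter_upwards [h1, h2] with z' hz' hz2
      have h3 : e (G z') - q z' = e (G z) - q z := hz2
      rw [h0, sub_self, sub_eq_zero] at h3
      have hs := isSaturated_psiGraph (z₀ := z₀) e he 0
      rw [← h3, ← h0]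
      simp only [add_zero] at hs
      exact ⟨hs _ hze _ hz', hs _ hz' _ hze⟩
  have := isPreconnected_univ.induction₂ _ (fun x _ => mem_nhdsWithin_of_mem_nhds (hstep x))
    (fun _ _ _ _ _ _ h1 h2 => h1.trans h2) (fun _ _ _ _ => Iff.symm)
    (Set.mem_univ c) (Set.mem_univ z)
  exact this.1 hc

end Coordinates

end Continuation

/-! ### Maximal continuation and leaf -/

section Maximality

variable {X : ∀ z : M, TangentSpace 𝓘(ℂ, ℂ) z} {z₀ : M}

section LocalFlow

theorem IsLocalFlow.eventually_isFlowMapAt {φ : ℂ → M} (hφ : IsLocalFlow X z₀ φ) :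
    ∀ᶠ t in 𝓝 (0 : ℂ), IsFlowMapAt X φ id t := by
  filter_upwards [hφ.2] with t ht
  exact ⟨ContinuousLinearMap.id ℂ ℂ, hasMFDerivAt_id t, ht.2⟩

variable [IsManifold 𝓘(ℂ, ℂ) ω M]

theorem exists_isLocalFlow (hX : IsSingularAnalytic X) (hz₀ : z₀ ∉ singSet X) :
    ∃ φ : ℂ → M, IsLocalFlow X z₀ φ := by
  obtain ⟨e, he, hz, h0⟩ := exists_isFlowBox hX hz₀ 0
  refine ⟨e.symm, by rw [← h0, e.left_inv hz], ?_⟩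
  filter_upwards [e.open_target.mem_nhds (h0 ▸ e.map_source hz)] with t ht
  exact ⟨compl_singSet_subset_starSet (he.source_subset (e.map_target ht)),
    he.hasMFDerivAt_symm t ht⟩

/-- The germ of the local flow is unique, and it is the germ of `π₁` in terms of `π₂`: a flow box
`e` with `e z₀ = 0` satisfies `e (φ t) = t` for every local flow `φ`. -/
theorem IsLocalFlow.eventually_fst_eq (hX : IsSingularAnalytic X) (hz₀ : z₀ ∉ singSet X)
    {φ : ℂ → M} (hφ : IsLocalFlow X z₀ φ) :
    ∀ᶠ r in 𝓝 (RSurface.basePoint X z₀ hz₀), r.fst = φ r.snd := by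
  obtain ⟨e, he, hz, h0⟩ := exists_isFlowBox hX hz₀ 0
  have hcont : ContinuousAt φ 0 := hφ.2.self_of_nhds.2.continuousAt
  have h1 : ∀ᶠ t in 𝓝 (0 : ℂ), φ t ∈ e.source :=
    hcont (e.open_source.mem_nhds (by rwa [hφ.1]))
  have h2 := eventually_eq_of_hasMFDerivAt_zero (u := e ∘ φ - id) (z₀ := 0) (by
    filter_upwards [h1, hφ.eventually_isFlowMapAt] with t ht ht2
    exact ht2.hasMFDerivAt_sub (he.hasMFDerivAt _ ht) (hX _ (he.source_subset ht)).2)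
  filter_upwards [(RSurface.isOpen_branch (z₀ := z₀) e.open_source he.source_subset
    he.hasMFDerivAt).mem_nhds (show _ ∧ _ from ⟨hz, h0.symm⟩),
    (RSurface.continuous_snd hX).continuousAt.eventually (h1.and h2)] with r hr hr2
  have h3 : e (φ r.snd) - r.snd = e (φ 0) - 0 := hr2.2
  rw [hφ.1, h0, sub_self, sub_eq_zero, hr.2] at h3
  have h4 := hr2.1
  rw [hr.2] at h4 ⊢
  exact (e.injOn h4 hr.1 h3).symm

end LocalFlow

variable [IsManifold 𝓘(ℂ, ℂ) ω M]

namespace RSurface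

/-- Every solution of `dG = X(G) dq` on a connected Riemann surface, with values in `M*`, that meets
`R_X` factors through `R_X`. -/
theorem exists_lift (hX : IsSingularAnalytic X)
    {Z : Type v} [TopologicalSpace Z] [ChartedSpace ℂ Z] [IsManifold 𝓘(ℂ, ℂ) ω Z]
    [PreconnectedSpace Z] {G : Z → M} {q : Z → ℂ} (hq : ContMDiff 𝓘(ℂ, ℂ) 𝓘(ℂ, ℂ) ω q)
    (hflow : ∀ z, IsFlowMapAt X G q z) (hmem : ∀ z, G z ∈ starSet X)
    {c : Z} (hc : (G c, q c) ∈ psiGraph X z₀) :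
    letI := chartedSpace (z₀ := z₀) hX
    ∃ h : Z → RSurface X z₀, ContMDiff 𝓘(ℂ, ℂ) 𝓘(ℂ, ℂ) ω h ∧ ∀ z, incl (h z) = (G z, q z) := by
  let := chartedSpace (z₀ := z₀) hX
  set h : Z → RSurface X z₀ := fun z => ⟨(G z, q z), mem_psiGraph_of_isFlowMapAt hX hflow hmem hc z⟩
  refine ⟨h, ?_, fun _ => rfl⟩
  refine contMDiff_of_comp_isLocalDiffeomorph
    (isLocalDiffeomorph_of_isLocalHomeomorph (isLocalHomeomorph_snd hX)) ?_ hq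
  exact continuous_iff_continuousAt.2 fun z =>
    continuousAt_of_isFlowMapAt hX (.of_forall hflow)

theorem isRiemannSurface [T2Space M] (hX : IsSingularAnalytic X) (hz₀ : z₀ ∉ singSet X) :
    letI := chartedSpace (z₀ := z₀) hX
    IsRiemannSurface (RSurface X z₀) := by
  let := chartedSpace (z₀ := z₀) hX
  exact ⟨isManifold_of_isLocalHomeomorph (isLocalHomeomorph_snd hX), t2Space hX,
    connectedSpace hX hz₀⟩

theorem isLocalDiffeomorph_snd (hX : IsSingularAnalytic X) :
    letI := chartedSpace (z₀ := z₀) hX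
    IsLocalDiffeomorph 𝓘(ℂ, ℂ) 𝓘(ℂ, ℂ) ω (snd : RSurface X z₀ → ℂ) :=
  isLocalDiffeomorph_of_isLocalHomeomorph (isLocalHomeomorph_snd hX)

theorem isMaximalAnalyticContinuation [T2Space M] (hX : IsSingularAnalytic X)
    (hz₀ : z₀ ∉ singSet X) {φ : ℂ → M} (hφ : IsLocalFlow X z₀ φ) :
    letI := chartedSpace (z₀ := z₀) hX
    IsMaximalAnalyticContinuation.{u, v} (starSet X) φ 0
      (snd : RSurface X z₀ → ℂ) (fst : RSurface X z₀ → M) (basePoint X z₀ hz₀) := by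
  let := chartedSpace (z₀ := z₀) hX
  refine ⟨⟨isRiemannSurface hX hz₀, isLocalDiffeomorph_snd hX,
    (isLocalDiffeomorph_fst hX).contMDiff,
    fun r => compl_singSet_subset_starSet r.fst_not_mem, rfl, hφ.eventually_fst_eq hX hz₀⟩, ?_⟩
  intro Z _ _ q G c hZ
  have := hZ.isRiemannSurface.isManifold
  have := hZ.isRiemannSurface.connected
  have hq := hZ.isLocalDiffeomorph.contMDiff
  have hGc : G c = z₀ := by rw [hZ.germ.self_of_nhds, hZ.map_base, hφ.1]
  have hc : ∀ᶠ z in 𝓝 c, IsFlowMapAt X G q z := by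
    have h1 : ∀ᶠ z in 𝓝 c, IsFlowMapAt X φ id (q z) :=
      hq.continuous.continuousAt.eventually (hZ.map_base ▸ hφ.eventually_isFlowMapAt)
    filter_upwards [h1, hZ.germ.eventually_nhds] with z hz1 hz2
    exact (hz1.comp (hq.mdifferentiable (by simp) z)).congr hz2 .rfl
  obtain ⟨h, hh, hi⟩ := exists_lift hX hq
    (isFlowMapAt_of_eventually hX hZ.holomorphic hq hZ.mem hc) hZ.mem
    (show (G c, q c) ∈ psiGraph X z₀ by rw [hGc, hZ.map_base]; exact IsPsiValue.base hz₀)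
  refine ⟨h, ⟨hh, ?_, ?_, ?_⟩, ?_⟩
  · exact funext fun z => congrArg Prod.snd (hi z)
  · exact funext fun z => congrArg Prod.fst (hi z)
  · exact Subtype.ext ((hi c).trans (by rw [hGc, hZ.map_base]; rfl))
  · rintro h' ⟨-, h1, h2, -⟩
    exact funext fun z => ext
      ((congrFun h2 z).trans (congrArg Prod.fst (hi z)).symm)
      ((congrFun h1 z).trans (congrArg Prod.snd (hi z)).symm)

theorem isLeaf [T2Space M] (hX : IsSingularAnalytic X) (hz₀ : z₀ ∉ singSet X) :
    letI := chartedSpace (z₀ := z₀) hX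
    IsLeaf.{u, v} (suspension X) (starSet X ×ˢ Set.univ) (incl : RSurface X z₀ → M × ℂ) := by
  let := chartedSpace (z₀ := z₀) hX
  have hder : ∀ r : RSurface X z₀, ∃ a : ℂ →L[ℂ] ℂ, Function.Bijective a ∧
      mfderiv 𝓘(ℂ, ℂ) (𝓘(ℂ, ℂ).prod 𝓘(ℂ, ℂ)) (incl : RSurface X z₀ → M × ℂ) r =
        ((ContinuousLinearMap.toSpanSingleton ℂ (show ℂ from X r.fst)).comp a).prod a := by
    intro r
    obtain ⟨a, ha, hG⟩ := isFlowMapAt hX r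
    refine ⟨a, ?_, (hG.prodMk ha).mfderiv⟩
    have h1 := (isLocalDiffeomorph_snd (z₀ := z₀) hX r).mfderivToContinuousLinearEquiv_coe (by simp)
    rw [ha.mfderiv] at h1
    rw [← h1]
    exact ContinuousLinearEquiv.bijective _
  refine ⟨⟨isRiemannSurface hX hz₀,
    (isLocalDiffeomorph_fst hX).contMDiff.prodMk (isLocalDiffeomorph_snd hX).contMDiff,
    Subtype.val_injective,
    fun r => ⟨compl_singSet_subset_starSet r.fst_not_mem, trivial⟩, fun r => ?_, fun r => ?_⟩, ?_⟩
  · obtain ⟨a, ha, h⟩ := hder r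
    rw [h]
    intro v w hvw
    exact ha.1 (congrArg Prod.snd hvw)
  · obtain ⟨a, ha, h⟩ := hder r
    rw [h]
    have key (x : ℂ) : LinearMap.range
        (((ContinuousLinearMap.toSpanSingleton ℂ x).comp a).prod a).toLinearMap =
        Submodule.span ℂ {(x, (1 : ℂ))} := by
      ext w
      rw [Submodule.mem_span_singleton]
      constructor
      · rintro ⟨v, rfl⟩
        exact ⟨a v, by simp⟩
      · rintro ⟨c, rfl⟩
        obtain ⟨v, rfl⟩ := ha.2 c
        exact ⟨v, by simp⟩
    exact key (X r.fst)
  · rintro L _ _ j hj ⟨_, ⟨r, rfl⟩, ⟨l, hl⟩⟩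
    have := hj.isRiemannSurface.isManifold
    have := hj.isRiemannSurface.connected
    have hflow : ∀ y, IsFlowMapAt X (fun y => (j y).1) (fun y => (j y).2) y := by
      intro y
      have hd := (hj.holomorphic.mdifferentiable (by simp) y).hasMFDerivAt
      have h1 := (hasMFDerivAt_fst (I := 𝓘(ℂ, ℂ)) (I' := 𝓘(ℂ, ℂ)) (x := j y)).comp y hd
      have h2 := (hasMFDerivAt_snd (I := 𝓘(ℂ, ℂ)) (I' := 𝓘(ℂ, ℂ)) (x := j y)).comp y hd
      refine ⟨_, h2, h1.congr_mfderiv (ContinuousLinearMap.ext fun v => ?_)⟩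
      have key (A : ℂ →L[ℂ] ℂ × ℂ) (x : ℂ)
          (hA : LinearMap.range A.toLinearMap = Submodule.span ℂ {(x, (1 : ℂ))}) (v : ℂ) :
          (A v).1 = (A v).2 * x := by
        obtain ⟨c, hc⟩ := Submodule.mem_span_singleton.1 (hA ▸ LinearMap.mem_range_self _ v)
        change c • (x, (1 : ℂ)) = A v at hc
        rw [← hc]
        simp
      exact key _ _ (hj.tangent y) v
    obtain ⟨h, hh, hi⟩ := exists_lift (z₀ := z₀) hX (contMDiff_snd.comp hj.holomorphic) hflow
      (fun y => (hj.mem y).1) (c := l) (show j l ∈ psiGraph X z₀ from hl ▸ r.2)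
    exact ⟨h, hh, funext hi⟩

end RSurface

section Suspension

/-- At the points of `M*` the coefficient of `X` is analytic, also at the isolated zeros. -/
theorem contMDiffAt_section_of_mem_starSet (hX : IsSingularAnalytic X) {p : M} (hp : p ∈ starSet X) :
    ContMDiffAt 𝓘(ℂ, ℂ) 𝓘(ℂ, ℂ).tangent ω
      (fun z : M => (⟨z, X z⟩ : TangentBundle 𝓘(ℂ, ℂ) M)) p := by
  have := isManifold_one (M := M)
  refine (Bundle.contMDiffAt_section (E := fun z : M => TangentSpace 𝓘(ℂ, ℂ) z) p).2 ?_
  have h1 : ContMDiffAt 𝓘(ℂ, ℂ) 𝓘(ℂ, ℂ) ω (coeff X p ∘ chartAt ℂ p) p :=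
    (analyticAt_coeff hX hp).contDiffAt.contMDiffAt.comp p
      (contMDiffOn_chart.contMDiffAt ((chartAt ℂ p).open_source.mem_nhds (mem_chart_source ℂ p)))
  refine h1.congr_of_eventuallyEq ?_
  filter_upwards [(chartAt ℂ p).open_source.mem_nhds (mem_chart_source ℂ p)] with z hz
  rw [Function.comp_apply, coeff_chartAt hz]
  have h2 := TangentBundle.continuousLinearMapAt_trivializationAt (I := 𝓘(ℂ, ℂ)) hz
  have h3 := congrArg (fun T : ℂ →L[ℂ] ℂ => T (show ℂ from X z)) h2
  refine Eq.trans ?_ h3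
  exact (congrFun ((trivializationAt ℂ (TangentSpace 𝓘(ℂ, ℂ)) p).coe_linearMapAt_of_mem (R := ℂ)
    (show z ∈ (trivializationAt ℂ (TangentSpace 𝓘(ℂ, ℂ)) p).baseSet from hz)) (X z)).symm

theorem contMDiffOn_suspension (hX : IsSingularAnalytic X) :
    ContMDiffOn (𝓘(ℂ, ℂ).prod 𝓘(ℂ, ℂ)) (𝓘(ℂ, ℂ).prod 𝓘(ℂ, ℂ)).tangent ω
      (fun q : M × ℂ =>
        (⟨q, suspension X q⟩ : TangentBundle (𝓘(ℂ, ℂ).prod 𝓘(ℂ, ℂ)) (M × ℂ)))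
      (starSet X ×ˢ Set.univ) := by
  have := isManifold_one (M := M)
  rintro ⟨p, t⟩ ⟨hp, -⟩
  have h1 := (contMDiffAt_section_of_mem_starSet hX hp).comp (p, t)
    (contMDiffAt_fst (I := 𝓘(ℂ, ℂ)) (J := 𝓘(ℂ, ℂ)) (N := ℂ))
  have h2 : ContMDiff 𝓘(ℂ, ℂ) 𝓘(ℂ, ℂ).tangent ω
      (fun t : ℂ => (⟨t, (1 : ℂ)⟩ : TangentBundle 𝓘(ℂ, ℂ) ℂ)) :=
    contMDiff_vectorSpace_iff_contDiff.2 contDiff_const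
  have h3 := h2.contMDiffAt.comp (p, t)
    (contMDiffAt_snd (I := 𝓘(ℂ, ℂ)) (J := 𝓘(ℂ, ℂ)) (M := M))
  exact (contMDiff_equivTangentBundleProd_symm.contMDiffAt.comp (p, t)
    (h1.prodMk h3)).contMDiffWithinAt

end Suspension

end Maximality

end ComplexFlow

end

open ComplexFlow in
theorem theorem1p3 {M : Type u} [TopologicalSpace M] [T2Space M] [ChartedSpace ℂ M]
    [IsManifold 𝓘(ℂ, ℂ) ω M] (X : ∀ z : M, TangentSpace 𝓘(ℂ, ℂ) z) (hX : IsSingularAnalytic X)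
    (z₀ : M) (hz₀ : z₀ ∉ singSet X) :
    -- the graph of `Ψ_X` is a Riemann surface spread over both factors
    (∃ _ : ChartedSpace ℂ (RSurface X z₀),
      IsRiemannSurface (RSurface X z₀) ∧
      IsLocalDiffeomorph 𝓘(ℂ, ℂ) 𝓘(ℂ, ℂ) ω (RSurface.fst : RSurface X z₀ → M) ∧
      IsLocalDiffeomorph 𝓘(ℂ, ℂ) 𝓘(ℂ, ℂ) ω (RSurface.snd : RSurface X z₀ → ℂ) ∧
      -- the maximal analytic continuation of the local flow is single-valued on it
      (∃ φ : ℂ → M, IsLocalFlow X z₀ φ) ∧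
      (∀ φ : ℂ → M, IsLocalFlow X z₀ φ →
        IsMaximalAnalyticContinuation.{u, v} (starSet X) φ 0
          (RSurface.snd : RSurface X z₀ → ℂ) (RSurface.fst : RSurface X z₀ → M)
          (RSurface.basePoint X z₀ hz₀)) ∧
      -- it is a leaf of the foliation of `M* × ℂ_t`
      IsLeaf.{u, v} (suspension X) (starSet X ×ˢ Set.univ)
        (RSurface.incl : RSurface X z₀ → M × ℂ)) ∧
    -- `X + ∂/∂t` is a complex analytic vector field on `M* × ℂ_t`
    IsOpen (starSet X) ∧
    ContMDiffOn (𝓘(ℂ, ℂ).prod 𝓘(ℂ, ℂ)) (𝓘(ℂ, ℂ).prod 𝓘(ℂ, ℂ)).tangent ω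
      (fun q : M × ℂ =>
        (⟨q, suspension X q⟩ : TangentBundle (𝓘(ℂ, ℂ).prod 𝓘(ℂ, ℂ)) (M × ℂ)))
      (starSet X ×ˢ Set.univ) ∧
    -- a change of the initial condition translates the surface in `t`
    (∀ z₁ ∈ connectedComponentIn (singSet X)ᶜ z₀,
      (∃ c : ℂ, IsPsiValue X z₀ z₁ c) ∧
      ∀ c : ℂ, IsPsiValue X z₀ z₁ c →
        psiGraph X z₀ = (fun q : M × ℂ => (q.1, q.2 + c)) '' psiGraph X z₁) ∧
    -- and this concerns every initial condition when the singular set is countable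
    ((singSet X).Countable →
      connectedComponent z₀ ∩ (singSet X)ᶜ ⊆ connectedComponentIn (singSet X)ᶜ z₀) := by
  refine ⟨⟨RSurface.chartedSpace hX, RSurface.isRiemannSurface hX hz₀,
    RSurface.isLocalDiffeomorph_fst hX, RSurface.isLocalDiffeomorph_snd hX,
    exists_isLocalFlow hX hz₀,
    fun φ hφ => RSurface.isMaximalAnalyticContinuation hX hz₀ hφ, RSurface.isLeaf hX hz₀⟩,
    isOpen_starSet, contMDiffOn_suspension hX,
    fun z₁ hz₁ => ⟨exists_isPsiValue hX hz₁, fun c hc => psiGraph_eq_image hX hc⟩,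
    fun hs => connectedComponent_inter_subset_of_countable hs hz₀⟩
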